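/- \textbf{Setting.} Let $n\ge 1$, $T>0$, $\gamma_0=1/T$, and let $c_{ij}$ ($1\le j\le i\le n$) be known constants. Consider $$\dot x_0=u_0,\qquad \dot x_i=u_0x_{i+1}+\phi_i(t,u,x)\ (1\le i\le n-1),\qquad \dot x_n=u+\phi_n(t,u,x),\qquad y=(y_1,y_2)=(x_0,x_1),$$ where $x=(x_1,\dots,x_n)^{\mathrm T}$ and the $\phi_i$ are unknown continuous functions on $[0,T)\times\mathbf R\times\mathbf R^n$ with $|\phi_i(t,u,x)|\le \sum_{j=1}^{i}c_{ij}|x_j|$. Let $A\in\mathbf R^{n\times n}$ have ones on the first superdiagonal and zeros elsewhere, $b=(0,\dots,0,1)^{\mathrm T}$, $c=(1,0,\dots,0)$. For $\gamma>0$ let $P(\gamma)$ and $Q(\gamma)$ be the (unique) positive definite solutions of $$A^{\mathrm T}P+PA-Pbb^{\mathrm T}P=-\gamma P,\qquad AQ+QA^{\mathrm T}-Qc^{\mathrm T}cQ=-\gamma Q,$$ and put $P_n=P(1)$, $Q_n=Q(1)$, $E_n=\mathrm{diag}\{n-1,\dots,1,0\}$, $\Lambda=\lambda_{\max}(P_n)$,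 $\delta_{\mathrm c}=n\bigl(1+\lambda_{\max}(E_n+P_nE_nP_n^{-1})\bigr)$. Let $g_{ij}=c_{ij}T^{i+1-j}$ for $j<i$, $g_{ii}=c_{ii}T+n-i$, let $d\ge 0$ be given by $d^2=\max_{1\le j\le n}\sum_{i=j}^{n} i\,g_{ij}^2\,\gamma_0^{-2(i-j)}$, and let $\beta=\max\{\beta_1,\beta_2\}$ with $$\beta_1=8\sqrt2\,n\,d\,\Lambda\, cQ_nP_nQ_nc^{\mathrm T}+2\Bigl(2+\frac{\delta_{\mathrm c}}{n}\Bigr),\qquad \beta_2=4\sqrt2\,d\,\Lambda+2\Bigl(2n+2-\frac1n\Bigr).$$ \textbf{Theorem 2.} With $\gamma=\gamma(t)=\frac{T}{T-t}\gamma_0$, consider the observer-based output feedback $$\dot\xi=\beta A\xi+bu+\beta Q(\gamma)c^{\mathrm T}\bigl(\gamma^{n-1}y_2-c\xi\bigr),\qquad u=-\beta b^{\mathrm T}P(\gamma)\xi,\qquad u_0=-\frac{3}{T-t}x_0-\frac{\beta}{2}(T-t).$$ This feedback is smooth on $[0,T)$. There are positive constants $\upsilon_3,\upsilon_{30},\upsilon_4,\upsilon_{40},\upsilon_5,\upsilon_{50}$,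 depending only on $n$, $T$ and the $c_{ij}$, such that for all $\phi_i$ as above the following holds. For every initial condition $(x_0(0),x(0),\xi(0))$ the closed-loop system has a solution on $[0,T)$, and every solution satisfies, for all $t\in[0,T)$ (for a solution defined only on $[0,\tau)$ with $0<\tau\le T$: for all $t\in[0,\tau)$), $$|x_0(t)|\le (T-t)^2\Bigl(\frac{T-t}{T^3}|x_0(0)|+\frac{\beta t}{2T}\Bigr),\qquad |u_0(t)|\le (T-t)\Bigl(3(T-t)\Bigl(\frac{|x_0(0)|}{T^3}+\frac{\beta}{2T}\Bigr)+\beta\Bigr),$$ $$\|x(t)\|\le \upsilon_3\,\mathrm e^{\upsilon_{30}|x_0(0)|t}(T-t)^{3/2}\bigl(\|x(0)\|+\|\xi(0)\|\bigr),$$ $$\|\xi(t)\|\le \upsilon_4\,\mathrm e^{\upsilon_{40}|x_0(0)|t}(T-t)^{3/2}\bigl(\|x(0)\|+\|\xi(0)\|\bigr),$$ $$|u(t)|\le \upsilon_5\,\mathrm e^{\upsilon_{50}|x_0(0)|t}(T-t)^{1/2}\bigl(\|x(0)\|+\|\xi(0)\|\bigr).$$ Hence, for every solution on $[0,T)$,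 $x_0(t)$, $x(t)$, $\xi(t)$, $u_0(t)$ and $u(t)$ all converge to zero as $t\to T^-$. -/

import Mathlib

open scoped Matrix ContDiff Topology

noncomputable section

namespace PrescribedTime

/-- The shift matrix `A`: ones on the superdiagonal, zeros elsewhere. -/
def shiftA (n : ℕ) : Matrix (Fin n) (Fin n) ℝ :=
  Matrix.of fun i j => if (i : ℕ) + 1 = (j : ℕ) then 1 else 0

/-- The column `b = (0, …, 0, 1)ᵀ`. -/
def vecB (n : ℕ) : Fin n → ℝ := fun i => if (i : ℕ) + 1 = n then 1 else 0

/-- The row `c = (1, 0, …, 0)`. -/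
def vecC (n : ℕ) : Fin n → ℝ := fun i => if (i : ℕ) = 0 then 1 else 0

/-- `P` is a positive definite solution of `AᵀP + PA - P b bᵀ P = -γ P`. -/
def IsControlPLE (n : ℕ) (γ : ℝ) (P : Matrix (Fin n) (Fin n) ℝ) : Prop :=
  P.PosDef ∧
    (shiftA n)ᵀ * P + P * shiftA n - P * Matrix.vecMulVec (vecB n) (vecB n) * P = -(γ • P)

/-- `Q` is a positive definite solution of `AQ + QAᵀ - Q cᵀ c Q = -γ Q`. -/
def IsObserverPLE (n : ℕ) (γ : ℝ) (Q : Matrix (Fin n) (Fin n) ℝ) : Prop :=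
  Q.PosDef ∧
    shiftA n * Q + Q * (shiftA n)ᵀ - Q * Matrix.vecMulVec (vecC n) (vecC n) * Q = -(γ • Q)

/-- The positive definite solution `P(γ)` of the parametric Lyapunov equation. -/
def matP (n : ℕ) (γ : ℝ) : Matrix (Fin n) (Fin n) ℝ := Classical.epsilon (IsControlPLE n γ)

/-- The positive definite solution `Q(γ)` of the dual parametric Lyapunov equation. -/
def matQ (n : ℕ) (γ : ℝ) : Matrix (Fin n) (Fin n) ℝ := Classical.epsilon (IsObserverPLE n γ)

/-- The largest (real) eigenvalue of a matrix. -/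
def lambdaMax {n : ℕ} (M : Matrix (Fin n) (Fin n) ℝ) : ℝ := sSup (spectrum ℝ M)

/-- `E_n = diag(n-1, n-2, …, 1, 0)`. -/
def matE (n : ℕ) : Matrix (Fin n) (Fin n) ℝ :=
  Matrix.diagonal fun i => (n : ℝ) - 1 - ((i : ℕ) : ℝ)

/-- `δ_c = n (1 + λ_max(E_n + P_n E_n P_n⁻¹))`, where `P_n = P(1)`. -/
def deltaC (n : ℕ) : ℝ :=
  n * (1 + lambdaMax (matE n + matP n 1 * matE n * (matP n 1)⁻¹))

/-- `Λ = λ_max(P_n)`. -/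
def bigLambda (n : ℕ) : ℝ := lambdaMax (matP n 1)

/-- `g_ij = c_ij T^(i+1-j)` for `j < i`, and `g_ii = c_ii T + n - i` (with indices `1, …, n`;
the `Fin n` index `i` stands for the index `i + 1`). -/
def coefG {n : ℕ} (T : ℝ) (c : Fin n → Fin n → ℝ) (i j : Fin n) : ℝ :=
  if j = i then c i i * T + ((n : ℝ) - (((i : ℕ) : ℝ) + 1))
  else c i j * T ^ ((i : ℕ) + 1 - (j : ℕ))

/-- `d`, the nonnegative number with
`d² = max_j ∑_{i = j}^{n} g_ij² i / γ₀^(2(i-j))`, where `γ₀ = 1/T` (indices `1, …, n`). -/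
def coefD {n : ℕ} [NeZero n] (T : ℝ) (c : Fin n → Fin n → ℝ) : ℝ :=
  Real.sqrt (Finset.univ.sup' Finset.univ_nonempty fun j : Fin n =>
    ∑ i ∈ Finset.Ici j,
      coefG T c i j ^ 2 * (((i : ℕ) : ℝ) + 1) / (1 / T) ^ (2 * ((i : ℕ) - (j : ℕ))))

/-- `β₁ = 8 √2 n d Λ (c Q_n P_n Q_n cᵀ) + 2 (2 + δ_c / n)`. -/
def beta1 {n : ℕ} [NeZero n] (T : ℝ) (c : Fin n → Fin n → ℝ) : ℝ :=
  8 * Real.sqrt 2 * n * coefD T c * bigLambda n *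
      (vecC n ⬝ᵥ ((matQ n 1 * matP n 1 * matQ n 1) *ᵥ vecC n))
    + 2 * (2 + deltaC n / n)

/-- `β₂ = 4 √2 d Λ + 2 (2 n + 2 - 1 / n)`. -/
def beta2 {n : ℕ} [NeZero n] (T : ℝ) (c : Fin n → Fin n → ℝ) : ℝ :=
  4 * Real.sqrt 2 * coefD T c * bigLambda n + 2 * (2 * (n : ℝ) + 2 - 1 / n)

/-- `β = max {β₁, β₂}`. -/
def beta {n : ℕ} [NeZero n] (T : ℝ) (c : Fin n → Fin n → ℝ) : ℝ := max (beta1 T c) (beta2 T c)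

/-- `γ(t) = T γ₀ / (T - t)` with `γ₀ = 1 / T`. -/
def gam (T t : ℝ) : ℝ := T / (T - t) * (1 / T)

/-- The assumption on the nonlinearities `φ_i(t, u, x)`: they are continuous and
`|φ_i(t, u, x)| ≤ c_i1 |x_1| + ⋯ + c_ii |x_i|`. -/
def Admissible {n : ℕ} (T : ℝ) (c : Fin n → Fin n → ℝ)
    (φ : Fin n → ℝ → ℝ → EuclideanSpace ℝ (Fin n) → ℝ) : Prop :=
  (∀ i, ContinuousOn
    (fun p : ℝ × ℝ × EuclideanSpace ℝ (Fin n) => φ i p.1 p.2.1 p.2.2)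
    (Set.Ico 0 T ×ˢ Set.univ)) ∧
  ∀ i, ∀ t ∈ Set.Ico 0 T, ∀ u x, |φ i t u x| ≤ ∑ j ∈ Finset.Iic i, c i j * |x j|

/-- The output `y = (y₁, y₂) = (x₀, x₁)` of the system. -/
def output {n : ℕ} [NeZero n] (x₀ : ℝ) (x : EuclideanSpace ℝ (Fin n)) : ℝ × ℝ := (x₀, x 0)

/-- Right-hand side of the `x`-subsystem: `u₀ x_{i+1} + φ_i` for `i < n` and `u + φ_n` for the
last index. -/
def plantField {n : ℕ} (φ : Fin n → ℝ → ℝ → EuclideanSpace ℝ (Fin n) → ℝ)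
    (t u₀ u : ℝ) (x : EuclideanSpace ℝ (Fin n)) (i : Fin n) : ℝ :=
  (if h : (i : ℕ) + 1 < n then u₀ * x ⟨(i : ℕ) + 1, h⟩ else u) + φ i t u x

/-- The control law `u₀ = -3 y₁ / (T - t) - β (T - t) / 2`, where `y₁ = x₀`. -/
def control0 (T β t : ℝ) (y : ℝ × ℝ) : ℝ := -(3 / (T - t)) * y.1 - β / 2 * (T - t)

/-- The control law `u = -β bᵀ P(γ(t)) ξ`. -/
def control {n : ℕ} (T β t : ℝ) (ξ : EuclideanSpace ℝ (Fin n)) : ℝ :=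
  -β * (vecB n ⬝ᵥ (matP n (gam T t) *ᵥ ξ.ofLp))

/-- Right-hand side of the observer: `β A ξ + b u + β Q(γ) cᵀ (γ^(n-1) y₂ - c ξ)`. -/
def observerField {n : ℕ} (T β t u : ℝ) (y : ℝ × ℝ) (ξ : EuclideanSpace ℝ (Fin n))
    (i : Fin n) : ℝ :=
  β * (shiftA n *ᵥ ξ.ofLp) i + vecB n i * u
    + β * (matQ n (gam T t) *ᵥ vecC n) i *
      (gam T t ^ (n - 1) * y.2 - vecC n ⬝ᵥ ξ.ofLp)

/-- `(x₀, x, ξ)` with controls `u₀, u` is a solution on `[0, τ)` of the closed loop formed by the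
plant, the observer and the two control laws. -/
structure IsClosedLoop {n : ℕ} [NeZero n] (T β : ℝ)
    (φ : Fin n → ℝ → ℝ → EuclideanSpace ℝ (Fin n) → ℝ) (τ : ℝ)
    (x₀ : ℝ → ℝ) (x ξ : ℝ → EuclideanSpace ℝ (Fin n)) (u₀ u : ℝ → ℝ) : Prop where
  deriv_x₀ : ∀ t ∈ Set.Ico 0 τ, HasDerivWithinAt x₀ (u₀ t) (Set.Ico 0 τ) t
  deriv_x : ∀ t ∈ Set.Ico 0 τ, ∀ i,
    HasDerivWithinAt (fun s => x s i) (plantField φ t (u₀ t) (u t) (x t) i) (Set.Ico 0 τ) t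
  deriv_ξ : ∀ t ∈ Set.Ico 0 τ, ∀ i,
    HasDerivWithinAt (fun s => ξ s i)
      (observerField T β t (u t) (output (x₀ t) (x t)) (ξ t) i) (Set.Ico 0 τ) t
  eq_u₀ : ∀ t ∈ Set.Ico 0 τ, u₀ t = control0 T β t (output (x₀ t) (x t))
  eq_u : ∀ t ∈ Set.Ico 0 τ, u t = control T β t (ξ t)

/-- The feedback is smooth: on `[0, T)` the control laws and the observer dynamics are `C^∞`
functions of the time, the output, the control and the observer state. -/
def SmoothFeedback (n : ℕ) (T β : ℝ) : Prop :=
  ContDiffOn ℝ ∞ (fun p : ℝ × (ℝ × ℝ) => control0 T β p.1 p.2)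
    (Set.Ico 0 T ×ˢ Set.univ) ∧
  ContDiffOn ℝ ∞ (fun p : ℝ × EuclideanSpace ℝ (Fin n) => control T β p.1 p.2)
    (Set.Ico 0 T ×ˢ Set.univ) ∧
  ∀ i : Fin n, ContDiffOn ℝ ∞
    (fun p : ℝ × ℝ × (ℝ × ℝ) × EuclideanSpace ℝ (Fin n) =>
      observerField T β p.1 p.2.1 p.2.2.1 p.2.2.2 i)
    (Set.Ico 0 T ×ˢ Set.univ)

end PrescribedTime

end

open PrescribedTime

namespace PrescribedTime

/-! Write s = T - t, so that γ = 1/s. The x₀-equation is linear and explicitly solvable: with κ =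
x₀(0)/T³ + β/(2T) it gives u₀ = s(β - 3sκ). In the weighted states η_i = s^{-(n-i)} ξ_i, ζ_i =
s^{-2(n-i)} x_i and the error ε = ζ - η, the loop becomes autonomous up to the factor 1/s: s η' = Eη
+ βAη - β b bᵀPη + β Qcᵀ cε, s ε' = Eε + βAε - β Qcᵀ cε + v - 3κ s Aζ, where P = P(1), Q = Q(1) and
v, the scaled nonlinearity plus one copy of Eζ, satisfies |v| ≤ d|ζ|.

Take V = ηᵀPη + 2q εᵀQ⁻¹ε with q = cQPQcᵀ. The Lyapunov equations give decay at a rate proportional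
to β, and the weight 2q makes the observer's term in (cε)² cancel the one left by the coupling in
the η-equation. The two lower bounds on β absorb E and v, leaving V' ≤ (-3/s + 3|κ|K)V
(`lyap_dissipation`, `lyap_coupling_le`). Hence V is of order s³ times an exponential in |x₀(0)|t.
The states are bounded by V^{1/2}, while u = -(β/s) bᵀPη loses one power of s.

The gains are explicit. With G the signed Pascal matrix, G² = 1, Q = GᵀG and Q⁻¹ = GGᵀ; the equation
for Q⁻¹ is Pascal's rule, and P is Q with indices reversed. Since Q and Q⁻¹ are similar, Λ bounds
all three quadratic forms from above and below. A second Pascal factorization gives EQ⁻¹ + Q⁻¹E ≤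
(2n-1)Q⁻¹.

The φ_i are merely continuous, so existence is of Peano type: u₀ being a known function of time, the
(x, ξ)-system has linear growth on each [0, b] with b < T, and Euler polygons converge along an
ultrafilter to a global solution. -/

/-! ### Binomial identities -/

/-- Vandermonde's identity after the reflection k ↦ i - k; it computes the entries of GGᵀ. -/
theorem sum_choose_mul_choose {n i : ℕ} (hi : i < n) (j : ℕ) :
    ∑ k ∈ Finset.range n, i.choose k * j.choose k = (i + j).choose i := by
  have h1 : ∑ k ∈ Finset.range (i + 1), i.choose k * j.choose k = (i + j).choose i := by
    rw [add_comm i j, Nat.add_choose_eq, Finset.Nat.sum_antidiagonal_eq_sum_range_succ_mk]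
    refine Finset.sum_congr rfl fun k hk => ?_
    rw [Nat.choose_symm (Finset.mem_range_succ_iff.mp hk), mul_comm]
  rw [← h1]
  symm
  refine Finset.sum_subset (Finset.range_mono hi) fun k _ hk => ?_
  rw [Nat.choose_eq_zero_of_lt (by simpa using hk), zero_mul]

/-- The absorption rule (k+1) C(i+1, k+1) = (i+1) C(i, k) reduces this to Vandermonde. It is the
source of the weight i + j + 1 in `weighted_matR_posSemidef`. -/
theorem sum_succ_mul_choose_mul_choose {n i : ℕ} (hi : i < n) (j : ℕ) :
    ∑ k ∈ Finset.range n, (k + 1) * (i + 1).choose (k + 1) * (j + 1).choose (k + 1)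
      = (i + j + 1) * (i + j).choose i := by
  have h1 : ∑ k ∈ Finset.range (i + 1), i.choose k * (j + 1).choose (k + 1)
      = (i + j + 1).choose (i + 1) := by
    rw [show i + j + 1 = (j + 1) + i by ring, Nat.add_choose_eq,
      Finset.Nat.sum_antidiagonal_eq_sum_range_succ_mk, Finset.sum_range_succ' _ (i + 1)]
    simp only [Nat.sub_zero, Nat.choose_succ_self, mul_zero, add_zero]
    refine Finset.sum_congr rfl fun k hk => ?_
    rw [Nat.add_sub_add_right, Nat.choose_symm (Finset.mem_range_succ_iff.mp hk), mul_comm]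
  have h2 : ∑ k ∈ Finset.range n, i.choose k * (j + 1).choose (k + 1)
      = (i + j + 1).choose (i + 1) := by
    rw [← h1]
    symm
    refine Finset.sum_subset (Finset.range_mono hi) fun k _ hk => ?_
    rw [Nat.choose_eq_zero_of_lt (by simpa using hk), zero_mul]
  rw [Nat.add_one_mul_choose_eq, ← h2, Finset.sum_mul]
  refine Finset.sum_congr rfl fun k _ => ?_
  have := Nat.add_one_mul_choose_eq i k
  calc _ = ((i + 1).choose (k + 1) * (k + 1)) * (j + 1).choose (k + 1) := by ring
    _ = _ := by rw [← this]; ring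

/-- The product C(i,k) C(k,j) equals C(i,j) C(i-j, k-j), which leaves an alternating row sum of
Pascal's triangle. This is the involution property of the signed Pascal matrix. -/
theorem sum_alternating_choose_mul_choose {n i : ℕ} (hi : i < n) (j : ℕ) :
    ∑ k ∈ Finset.range n, (-1 : ℤ) ^ k * (i.choose k * k.choose j)
      = if i = j then (-1) ^ i else 0 := by
  have h0 : ∑ k ∈ Finset.range n, (-1 : ℤ) ^ k * (i.choose k * k.choose j)
      = ∑ k ∈ Finset.range (i + 1), (-1 : ℤ) ^ k * (i.choose k * k.choose j) := by
    symm
    refine Finset.sum_subset (Finset.range_mono hi) fun k _ hk => ?_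
    rw [Nat.choose_eq_zero_of_lt (by simpa using hk)]
    simp
  rw [h0]
  rcases lt_or_ge i j with h | h
  · rw [if_neg h.ne]
    refine Finset.sum_eq_zero fun k hk => ?_
    rw [Nat.choose_eq_zero_of_lt (k := j) (n := k) (by have := Finset.mem_range.mp hk; omega)]
    simp
  · obtain ⟨r, rfl⟩ := Nat.exists_eq_add_of_le h
    rw [add_assoc, Finset.sum_range_add, Finset.sum_eq_zero, zero_add]
    · have h1 : ∀ m ∈ Finset.range (r + 1),
          (-1 : ℤ) ^ (j + m) * ((j + r).choose (j + m) * (j + m).choose j)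
            = (-1) ^ j * (j + r).choose j * ((-1) ^ m * r.choose m) := by
        intro m _
        have := Nat.choose_mul (n := j + r) (k := j + m) (s := j) (by omega)
        rw [Nat.add_sub_cancel_left, Nat.add_sub_cancel_left] at this
        rw [pow_add]
        have h3 : (((j + r).choose (j + m) * (j + m).choose j : ℕ) : ℤ)
          = ((j + r).choose j * r.choose m : ℕ) := by rw [this]
        push_cast at h3
        rw [h3]; ring
      rw [Finset.sum_congr rfl h1, ← Finset.mul_sum, Int.alternating_sum_range_choose]
      rcases Nat.eq_zero_or_pos r with rfl | hr
      · simp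
      · rw [if_neg (by omega), if_neg (by omega), mul_zero]
    · intro k hk
      rw [Nat.choose_eq_zero_of_lt (k := j) (n := k) (by simpa using hk)]
      simp

/-! ### Pascal factorizations of the gain matrices -/

/-- The signed Pascal matrix `((-1)^i (i choose k))`. -/
noncomputable def signedPascal (n : ℕ) : Matrix (Fin n) (Fin n) ℝ :=
  Matrix.of fun i k => (-1) ^ (i : ℕ) * ((i : ℕ).choose (k : ℕ) : ℝ)

theorem signedPascal_mul_self (n : ℕ) : signedPascal n * signedPascal n = 1 := by
  ext i j
  simp only [signedPascal, Matrix.mul_apply, Matrix.of_apply, Matrix.one_apply]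
  have h := sum_alternating_choose_mul_choose i.2 (j : ℕ)
  have h' := congrArg (fun z : ℤ => (-1 : ℝ) ^ (i : ℕ) * (z : ℝ)) h
  beta_reduce at h'
  push_cast at h'
  rw [Finset.mul_sum] at h'
  rw [Fin.sum_univ_eq_sum_range (fun k => (-1 : ℝ) ^ (i : ℕ) * ((i : ℕ).choose k : ℝ) *
    ((-1) ^ k * (k.choose (j : ℕ) : ℝ))) n]
  rw [Finset.sum_congr rfl (fun k _ => by ring : ∀ k ∈ Finset.range n,
    (-1 : ℝ) ^ (i : ℕ) * ((i : ℕ).choose k : ℝ) * ((-1) ^ k * (k.choose (j : ℕ) : ℝ))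
      = (-1) ^ (i : ℕ) * ((-1) ^ k * (((i : ℕ).choose k : ℝ) * (k.choose (j : ℕ) : ℝ)))), h']
  by_cases hij : i = j
  · subst hij
    simp [← mul_pow]
  · rw [if_neg hij, if_neg (fun h => hij (Fin.ext h)), mul_zero]

/-- The inverse `G Gᵀ` of the observer gain matrix `Q(1)`, where `G` is the signed Pascal
matrix. -/
noncomputable def matR (n : ℕ) : Matrix (Fin n) (Fin n) ℝ := signedPascal n * (signedPascal n)ᵀ

/-- The explicit observer gain matrix `Q(1) = Gᵀ G`. -/
noncomputable def matQ₁ (n : ℕ) : Matrix (Fin n) (Fin n) ℝ := (signedPascal n)ᵀ * signedPascal n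

/-- The explicit control gain matrix `P(1)`, the reversal of `Q(1)`. -/
noncomputable def matP₁ (n : ℕ) : Matrix (Fin n) (Fin n) ℝ :=
  (matQ₁ n).submatrix Fin.revPerm Fin.revPerm

theorem matR_apply (n : ℕ) (i j : Fin n) :
    matR n i j = (-1) ^ ((i : ℕ) + j) * (((i : ℕ) + j).choose i : ℝ) := by
  have h := sum_choose_mul_choose i.2 (j : ℕ)
  have h' := congrArg (fun z : ℕ => (-1 : ℝ) ^ ((i : ℕ) + j) * (z : ℝ)) h
  beta_reduce at h'
  rw [← h']
  push_cast
  rw [Finset.mul_sum, ← Fin.sum_univ_eq_sum_range (fun k => (-1 : ℝ) ^ ((i : ℕ) + j) *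
    (((i : ℕ).choose k : ℝ) * ((j : ℕ).choose k : ℝ))) n]
  simp only [matR, signedPascal, Matrix.mul_apply, Matrix.of_apply, Matrix.transpose_apply]
  refine Finset.sum_congr rfl fun k _ => ?_
  rw [pow_add]; ring

theorem matR_mul_matQ₁ (n : ℕ) : matR n * matQ₁ n = 1 := by
  have h := signedPascal_mul_self n
  have h' : (signedPascal n)ᵀ * (signedPascal n)ᵀ = 1 := by
    rw [← Matrix.transpose_mul, h, Matrix.transpose_one]
  rw [matR, matQ₁, Matrix.mul_assoc, ← Matrix.mul_assoc _ _ (signedPascal n), h', Matrix.one_mul, h]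

theorem matQ₁_mul_matR (n : ℕ) : matQ₁ n * matR n = 1 :=
  mul_eq_one_comm.mp (matR_mul_matQ₁ n)

theorem isUnit_signedPascal (n : ℕ) : IsUnit (signedPascal n) :=
  IsUnit.of_mul_eq_one _ (signedPascal_mul_self n)

theorem matR_posDef (n : ℕ) : (matR n).PosDef := by
  have := Matrix.PosDef.mul_conjTranspose_self (signedPascal n)
    (Matrix.vecMul_injective_iff_isUnit.mpr (isUnit_signedPascal n))
  simpa [matR] using this

theorem matQ₁_posDef (n : ℕ) : (matQ₁ n).PosDef := by
  have := Matrix.PosDef.conjTranspose_mul_self (signedPascal n)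
    (Matrix.mulVec_injective_iff_isUnit.mpr (isUnit_signedPascal n))
  simpa [matQ₁] using this

theorem matP₁_posDef (n : ℕ) : (matP₁ n).PosDef :=
  (matQ₁_posDef n).submatrix Fin.revPerm.injective

/-- The matrix `((i + j + 1) R_ij)` is positive semidefinite. -/
theorem weighted_matR_posSemidef (n : ℕ) :
    (Matrix.of fun i j : Fin n => (((i : ℕ) : ℝ) + (j : ℕ) + 1) * matR n i j).PosSemidef := by
  -- The factorization is H D Hᵀ with D = diag(k + 1) and H the signed Pascal matrix with both
  -- binomial arguments raised by one.
  have h := (Matrix.PosSemidef.diagonal (n := Fin n) (R := ℝ) (d := fun k => ((k : ℕ) : ℝ) + 1)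
    (by intro k; show (0 : ℝ) ≤ _; positivity)).mul_mul_conjTranspose_same
    (Matrix.of fun i k : Fin n => (-1 : ℝ) ^ (i : ℕ) * (((i : ℕ) + 1).choose ((k : ℕ) + 1) : ℝ))
  convert h using 1
  ext i j
  rw [Matrix.mul_apply]
  simp only [Matrix.mul_diagonal, Matrix.of_apply, Matrix.conjTranspose_apply, star_trivial]
  rw [matR_apply]
  have h := sum_succ_mul_choose_mul_choose i.2 (j : ℕ)
  have h' := congrArg (fun z : ℕ => (-1 : ℝ) ^ ((i : ℕ) + j) * (z : ℝ)) h
  beta_reduce at h'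
  push_cast at h'
  rw [Finset.mul_sum, ← Fin.sum_univ_eq_sum_range (fun k => (-1 : ℝ) ^ ((i : ℕ) + j) *
    (((k : ℝ) + 1) * (((i : ℕ) + 1).choose (k + 1) : ℝ) * (((j : ℕ) + 1).choose (k + 1) : ℝ))) n]
    at h'
  rw [mul_left_comm, ← h']
  refine Finset.sum_congr rfl fun k _ => ?_
  rw [pow_add]; ring

/-! ### Solution and uniqueness of the parametric Lyapunov equations -/

theorem mul_shiftA_apply {n : ℕ} (M : Matrix (Fin n) (Fin n) ℝ) (i j : Fin n) :
    (M * shiftA n) i j =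
      if 0 < (j : ℕ) then M i ⟨(j : ℕ) - 1, (Nat.sub_le _ _).trans_lt j.2⟩ else 0 := by
  simp only [Matrix.mul_apply, shiftA, Matrix.of_apply]
  split_ifs with h
  · rw [Finset.sum_eq_single ⟨(j : ℕ) - 1, (Nat.sub_le _ _).trans_lt j.2⟩]
    · simp [Nat.sub_add_cancel h]
    · intro k _ hk
      rw [if_neg, mul_zero]
      intro h'
      exact hk (Fin.ext (by simp; omega))
    · simp
  · refine Finset.sum_eq_zero fun k _ => ?_
    rw [if_neg (by omega), mul_zero]

theorem transpose_shiftA_mul_apply {n : ℕ} (M : Matrix (Fin n) (Fin n) ℝ) (i j : Fin n) :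
    ((shiftA n)ᵀ * M) i j =
      if 0 < (i : ℕ) then M ⟨(i : ℕ) - 1, (Nat.sub_le _ _).trans_lt i.2⟩ j else 0 := by
  have := mul_shiftA_apply Mᵀ j i
  rw [← Matrix.transpose_apply (Mᵀ * shiftA n), Matrix.transpose_mul, Matrix.transpose_transpose]
    at this
  simpa using this

/-- Since A is a shift, the (i, j) entry of the left side involves only entries of D with index sum
i + j - 1. Induction on the index sum therefore kills every entry. -/
theorem eq_zero_of_lyapunov {n : ℕ} {γ : ℝ} (hγ : γ ≠ 0) {D : Matrix (Fin n) (Fin n) ℝ}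
    (h : D * shiftA n + (shiftA n)ᵀ * D = -(γ • D)) : D = 0 := by
  have key : ∀ m : ℕ, ∀ i j : Fin n, (i : ℕ) + j = m → D i j = 0 := by
    intro m
    induction m using Nat.strong_induction_on with
    | _ m ih =>
      intro i j hij
      have e := congrFun (congrFun h i) j
      rw [Matrix.add_apply, mul_shiftA_apply, transpose_shiftA_mul_apply, Matrix.neg_apply,
        Matrix.smul_apply, smul_eq_mul] at e
      have e1 : (if 0 < (j : ℕ) then D i ⟨(j : ℕ) - 1, (Nat.sub_le _ _).trans_lt j.2⟩ else 0)
          = 0 := by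
        split_ifs with hj
        · exact ih ((i : ℕ) + (j - 1)) (by omega) _ _ rfl
        · rfl
      have e2 : (if 0 < (i : ℕ) then D ⟨(i : ℕ) - 1, (Nat.sub_le _ _).trans_lt i.2⟩ j else 0)
          = 0 := by
        split_ifs with hi
        · exact ih ((i : ℕ) - 1 + j) (by omega) _ _ rfl
        · rfl
      rw [e1, e2, add_zero, zero_eq_neg] at e
      exact (mul_eq_zero.mp e).resolve_left hγ
  ext i j
  exact key _ i j rfl

/-- In the interior this is Pascal's rule, the sign coming from the drop of the index sum by one. On
the borders a single neighbour remains, and cᵀc accounts for the corner. -/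
theorem matR_lyapunov (n : ℕ) :
    matR n * shiftA n + (shiftA n)ᵀ * matR n - Matrix.vecMulVec (vecC n) (vecC n) = -matR n := by
  ext ⟨i, hi⟩ ⟨j, hj⟩
  rw [Matrix.sub_apply, Matrix.add_apply, mul_shiftA_apply, transpose_shiftA_mul_apply,
    Matrix.neg_apply, Matrix.vecMulVec_apply]
  simp only [matR_apply, vecC]
  rcases i with _ | i <;> rcases j with _ | j
  · simp
  · simp [pow_succ]
  · simp [pow_succ]
  · have h := Nat.choose_succ_succ (i + j + 1) i
    have h' : ((i + 1 + (j + 1)).choose (i + 1) : ℝ)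
        = ((i + j + 1).choose i : ℝ) + ((i + j + 1).choose (i + 1) : ℝ) := by
      rw [show i + 1 + (j + 1) = (i + j + 1).succ by omega]
      exact_mod_cast h
    simp only [Nat.succ_pos, if_true, Nat.add_sub_cancel, h',
      show i + 1 + j = i + j + 1 by omega, show i + (j + 1) = i + j + 1 by omega]
    simp
    ring

/-- Multiplying by Q⁻¹ on both sides makes the quadratic equation affine in Q⁻¹. Two solutions then
differ by a solution of the homogeneous equation of `eq_zero_of_lyapunov`. -/
theorem isObserverPLE_iff_inv {n : ℕ} {γ : ℝ} {Q : Matrix (Fin n) (Fin n) ℝ} (hQ : Q.PosDef) :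
    IsObserverPLE n γ Q ↔
      Q⁻¹ * shiftA n + (shiftA n)ᵀ * Q⁻¹ - Matrix.vecMulVec (vecC n) (vecC n) = -(γ • Q⁻¹) := by
  have hu : IsUnit Q.det := (Matrix.isUnit_iff_isUnit_det Q).mp hQ.isUnit
  have h1 : Q * Q⁻¹ = 1 := Matrix.mul_nonsing_inv Q hu
  have h2 : Q⁻¹ * Q = 1 := Matrix.nonsing_inv_mul Q hu
  constructor
  · rintro ⟨-, h⟩
    have := congrArg (fun M => Q⁻¹ * M * Q⁻¹) h
    simp only [Matrix.mul_sub, Matrix.mul_add, Matrix.sub_mul, Matrix.add_mul, Matrix.mul_neg,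
      Matrix.neg_mul, Matrix.mul_smul, Matrix.smul_mul, h2, Matrix.one_mul] at this
    simp only [Matrix.mul_assoc, h1, Matrix.mul_one] at this
    simpa only [← Matrix.mul_assoc, h2, Matrix.one_mul] using this
  · intro h
    refine ⟨hQ, ?_⟩
    have := congrArg (fun M => Q * M * Q) h
    simp only [Matrix.mul_sub, Matrix.mul_add, Matrix.sub_mul, Matrix.add_mul, Matrix.mul_neg,
      Matrix.neg_mul, Matrix.mul_smul, Matrix.smul_mul, h1, Matrix.one_mul] at this
    simp only [Matrix.mul_assoc, h2, Matrix.mul_one] at this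
    rw [← Matrix.mul_assoc Q Q⁻¹, h1, Matrix.one_mul] at this
    simpa only [Matrix.mul_assoc] using this

theorem IsObserverPLE.unique {n : ℕ} {γ : ℝ} (hγ : γ ≠ 0) {Q Q' : Matrix (Fin n) (Fin n) ℝ}
    (h : IsObserverPLE n γ Q) (h' : IsObserverPLE n γ Q') : Q = Q' := by
  have e := (isObserverPLE_iff_inv h.1).mp h
  have e' := (isObserverPLE_iff_inv h'.1).mp h'
  have hD : Q⁻¹ - Q'⁻¹ = 0 := by
    refine eq_zero_of_lyapunov hγ ?_
    rw [Matrix.sub_mul, Matrix.mul_sub, smul_sub, neg_sub]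
    have := congrArg₂ (· - ·) e e'
    beta_reduce at this
    rw [← sub_eq_zero] at this ⊢
    rw [← this]
    abel
  have hi := congrArg (·⁻¹) (sub_eq_zero.mp hD)
  beta_reduce at hi
  rwa [Matrix.nonsing_inv_nonsing_inv _ ((Matrix.isUnit_iff_isUnit_det _).mp h.1.isUnit),
    Matrix.nonsing_inv_nonsing_inv _ ((Matrix.isUnit_iff_isUnit_det _).mp h'.1.isUnit)] at hi

theorem inv_matQ₁ (n : ℕ) : (matQ₁ n)⁻¹ = matR n := Matrix.inv_eq_left_inv (matR_mul_matQ₁ n)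

theorem isObserverPLE_matQ₁ (n : ℕ) : IsObserverPLE n 1 (matQ₁ n) := by
  rw [isObserverPLE_iff_inv (matQ₁_posDef n), inv_matQ₁, one_smul]
  exact matR_lyapunov n

/-- The explicit observer gain `Q(γ)`, with entries `γ^(i+j+1) Q(1)_ij`. -/
noncomputable def scaledQ (n : ℕ) (γ : ℝ) : Matrix (Fin n) (Fin n) ℝ :=
  γ • (Matrix.diagonal (fun i : Fin n => γ ^ (i : ℕ)) * matQ₁ n *
    Matrix.diagonal (fun i : Fin n => γ ^ (i : ℕ)))

theorem scaledQ_apply (n : ℕ) (γ : ℝ) (i j : Fin n) :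
    scaledQ n γ i j = γ ^ ((i : ℕ) + j + 1) * matQ₁ n i j := by
  simp only [scaledQ, Matrix.smul_apply, Matrix.mul_diagonal, Matrix.diagonal_mul, smul_eq_mul]
  ring

theorem shiftA_mul_diagonal (n : ℕ) (γ : ℝ) :
    shiftA n * Matrix.diagonal (fun i : Fin n => γ ^ (i : ℕ)) =
      γ • (Matrix.diagonal (fun i : Fin n => γ ^ (i : ℕ)) * shiftA n) := by
  ext i j
  simp only [Matrix.mul_diagonal, Matrix.smul_apply, Matrix.diagonal_mul, shiftA, Matrix.of_apply,
    smul_eq_mul]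
  split_ifs with h
  · rw [← h]; ring
  · simp

theorem diagonal_mul_vecMulVec_vecC (n : ℕ) (γ : ℝ) :
    Matrix.diagonal (fun i : Fin n => γ ^ (i : ℕ)) * Matrix.vecMulVec (vecC n) (vecC n) *
      Matrix.diagonal (fun i : Fin n => γ ^ (i : ℕ)) = Matrix.vecMulVec (vecC n) (vecC n) := by
  ext i j
  simp only [Matrix.mul_diagonal, Matrix.diagonal_mul, Matrix.vecMulVec_apply, vecC]
  by_cases hi : (i : ℕ) = 0 <;> by_cases hj : (j : ℕ) = 0 <;> simp [hi, hj]

/-- The dilation D = diag(γ^i) satisfies AD = γDA and leaves cᵀc fixed, so each term of the equation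
at γ is γ² times the D-conjugate of the corresponding term at 1. -/
theorem isObserverPLE_scaledQ (n : ℕ) {γ : ℝ} (hγ : 0 < γ) : IsObserverPLE n γ (scaledQ n γ) := by
  constructor
  · have hD : (Matrix.diagonal (fun i : Fin n => γ ^ (i : ℕ))).PosDef :=
      Matrix.PosDef.diagonal fun i => pow_pos hγ _
    have := (matQ₁_posDef n).mul_mul_conjTranspose_same
      (Matrix.vecMul_injective_iff_isUnit.mpr hD.isUnit)
    rw [hD.isHermitian.eq] at this
    exact this.smul hγ
  · have h1 := shiftA_mul_diagonal n γ
    have h2 := congrArg Matrix.transpose h1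
    rw [Matrix.transpose_mul, Matrix.transpose_smul, Matrix.transpose_mul,
      Matrix.diagonal_transpose] at h2
    have h3 := diagonal_mul_vecMulVec_vecC n γ
    have h4 := (isObserverPLE_matQ₁ n).2
    unfold scaledQ
    generalize Matrix.diagonal (fun i : Fin n => γ ^ (i : ℕ)) = D at *
    generalize matQ₁ n = Q at *
    generalize Matrix.vecMulVec (vecC n) (vecC n) = C at *
    have e1 : shiftA n * γ • (D * Q * D) = γ ^ 2 • (D * (shiftA n * Q) * D) := by
      rw [Matrix.mul_smul, ← Matrix.mul_assoc, ← Matrix.mul_assoc, h1, sq, mul_smul]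
      simp only [Matrix.smul_mul, Matrix.mul_assoc]
    have e2 : γ • (D * Q * D) * (shiftA n)ᵀ = γ ^ 2 • (D * (Q * (shiftA n)ᵀ) * D) := by
      rw [Matrix.smul_mul, Matrix.mul_assoc, h2, sq, mul_smul]
      simp only [Matrix.mul_smul, Matrix.mul_assoc]
    have e3 : γ • (D * Q * D) * C * γ • (D * Q * D) = γ ^ 2 • (D * (Q * C * Q) * D) := by
      have : D * (Q * C * Q) * D = D * Q * (D * C * D) * Q * D := by
        rw [h3]; simp only [Matrix.mul_assoc]
      rw [this, sq, mul_smul]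
      simp only [Matrix.smul_mul, Matrix.mul_smul, Matrix.mul_assoc]
    rw [e1, e2, e3, ← smul_add, ← smul_sub, ← Matrix.add_mul, ← Matrix.mul_add, ← Matrix.sub_mul,
      ← Matrix.mul_sub, h4, sq, mul_smul]
    simp

/-! ### Index reversal: from the observer equation to the control equation -/

theorem shiftA_submatrix_rev (n : ℕ) :
    (shiftA n).submatrix Fin.revPerm Fin.revPerm = (shiftA n)ᵀ := by
  ext i j
  simp only [Matrix.submatrix_apply, shiftA, Matrix.of_apply, Matrix.transpose_apply,
    Fin.revPerm_apply, Fin.val_rev]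
  congr 1
  have := i.2
  have := j.2
  exact propext (by omega)

theorem vecC_rev (n : ℕ) (i : Fin n) : vecC n i.rev = vecB n i := by
  simp only [vecC, vecB, Fin.val_rev]
  congr 1
  have := i.2
  exact propext (by omega)

theorem vecMulVec_submatrix_rev (n : ℕ) :
    (Matrix.vecMulVec (vecC n) (vecC n)).submatrix Fin.revPerm Fin.revPerm =
      Matrix.vecMulVec (vecB n) (vecB n) := by
  ext i j
  simp [Matrix.vecMulVec_apply, vecC_rev]

theorem submatrix_rev_mul {n : ℕ} (M N : Matrix (Fin n) (Fin n) ℝ) :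
    (M * N).submatrix Fin.revPerm Fin.revPerm =
      M.submatrix Fin.revPerm Fin.revPerm * N.submatrix Fin.revPerm Fin.revPerm :=
  (Matrix.submatrix_mul_equiv M N Fin.revPerm Fin.revPerm Fin.revPerm).symm

theorem submatrix_rev_rev {n : ℕ} (M : Matrix (Fin n) (Fin n) ℝ) :
    (M.submatrix Fin.revPerm Fin.revPerm).submatrix Fin.revPerm Fin.revPerm = M := by
  ext i j
  simp

/-- Reversing the indices exchanges A with Aᵀ and c with b, so every fact about the observer
equation transfers to the control equation. -/
theorem IsObserverPLE.reverse {n : ℕ} {γ : ℝ} {Q : Matrix (Fin n) (Fin n) ℝ}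
    (h : IsObserverPLE n γ Q) :
    IsControlPLE n γ (Q.submatrix Fin.revPerm Fin.revPerm) := by
  refine ⟨h.1.submatrix Fin.revPerm.injective, ?_⟩
  have e := congrArg (fun M => M.submatrix Fin.revPerm Fin.revPerm) h.2
  have h2 := congrArg Matrix.transpose (shiftA_submatrix_rev n)
  rw [Matrix.transpose_submatrix, Matrix.transpose_transpose] at h2
  simpa only [Matrix.submatrix_add, Matrix.submatrix_sub, Pi.add_apply, Pi.sub_apply,
    submatrix_rev_mul, shiftA_submatrix_rev, h2, vecMulVec_submatrix_rev, Matrix.submatrix_neg,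
    Matrix.submatrix_smul, Pi.neg_apply, Pi.smul_apply] using e

theorem IsControlPLE.reverse {n : ℕ} {γ : ℝ} {P : Matrix (Fin n) (Fin n) ℝ}
    (h : IsControlPLE n γ P) :
    IsObserverPLE n γ (P.submatrix Fin.revPerm Fin.revPerm) := by
  refine ⟨h.1.submatrix Fin.revPerm.injective, ?_⟩
  have e := congrArg (fun M => M.submatrix Fin.revPerm Fin.revPerm) h.2
  have h2 := congrArg Matrix.transpose (shiftA_submatrix_rev n)
  rw [Matrix.transpose_submatrix, Matrix.transpose_transpose] at h2
  have h3 := congrArg (fun M => M.submatrix Fin.revPerm Fin.revPerm) (vecMulVec_submatrix_rev n)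
  simp only [submatrix_rev_rev] at h3
  simpa only [Matrix.submatrix_add, Matrix.submatrix_sub, Pi.add_apply, Pi.sub_apply,
    submatrix_rev_mul, shiftA_submatrix_rev, h2, ← h3, Matrix.submatrix_neg,
    Matrix.submatrix_smul, Pi.neg_apply, Pi.smul_apply] using e

theorem IsControlPLE.unique {n : ℕ} {γ : ℝ} (hγ : γ ≠ 0) {P P' : Matrix (Fin n) (Fin n) ℝ}
    (h : IsControlPLE n γ P) (h' : IsControlPLE n γ P') : P = P' := by
  rw [← submatrix_rev_rev P, h.reverse.unique hγ h'.reverse, submatrix_rev_rev]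

/-- Existence makes the choice operator return a solution; uniqueness identifies it with the
explicit one. -/
theorem matQ_eq (n : ℕ) {γ : ℝ} (hγ : 0 < γ) : matQ n γ = scaledQ n γ :=
  (Classical.epsilon_spec ⟨_, isObserverPLE_scaledQ n hγ⟩ :
    IsObserverPLE n γ (matQ n γ)).unique hγ.ne' (isObserverPLE_scaledQ n hγ)

theorem matP_eq (n : ℕ) {γ : ℝ} (hγ : 0 < γ) :
    matP n γ = (scaledQ n γ).submatrix Fin.revPerm Fin.revPerm :=
  (Classical.epsilon_spec ⟨_, (isObserverPLE_scaledQ n hγ).reverse⟩ :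
    IsControlPLE n γ (matP n γ)).unique hγ.ne' (isObserverPLE_scaledQ n hγ).reverse

theorem matQ_one (n : ℕ) : matQ n 1 = matQ₁ n := by
  rw [matQ_eq n one_pos]
  ext i j
  rw [scaledQ_apply, one_pow, one_mul]

theorem matP_one (n : ℕ) : matP n 1 = matP₁ n := by
  rw [matP_eq n one_pos, ← matQ_eq n one_pos, matQ_one, matP₁]

theorem matQ_apply (n : ℕ) {γ : ℝ} (hγ : 0 < γ) (i j : Fin n) :
    matQ n γ i j = γ ^ ((i : ℕ) + j + 1) * matQ₁ n i j := by
  rw [matQ_eq n hγ, scaledQ_apply]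

theorem matP_apply (n : ℕ) {γ : ℝ} (hγ : 0 < γ) (i j : Fin n) :
    matP n γ i j = γ ^ ((i.rev : ℕ) + j.rev + 1) * matP₁ n i j := by
  rw [matP_eq n hγ, Matrix.submatrix_apply, scaledQ_apply]
  rfl

theorem isControlPLE_matP₁ (n : ℕ) : IsControlPLE n 1 (matP₁ n) := (isObserverPLE_matQ₁ n).reverse

theorem gain_matrices_wellDefined (n : ℕ) {γ : ℝ} (hγ : 0 < γ) :
    ((∃! P, IsControlPLE n γ P) ∧ IsControlPLE n γ (matP n γ)) ∧
      ((∃! Q, IsObserverPLE n γ Q) ∧ IsObserverPLE n γ (matQ n γ)) := by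
  have hQ := isObserverPLE_scaledQ n hγ
  refine ⟨⟨⟨_, hQ.reverse, fun P hP => hP.unique hγ.ne' hQ.reverse⟩, ?_⟩,
    ⟨⟨_, hQ, fun Q hQ' => hQ'.unique hγ.ne' hQ⟩, ?_⟩⟩
  · rw [matP_eq n hγ]; exact hQ.reverse
  · rw [matQ_eq n hγ]; exact hQ

/-! ### Spectral bounds for the quadratic forms -/

theorem dotProduct_mulVec_le_of_spectrum_le {n : ℕ} {M : Matrix (Fin n) (Fin n) ℝ}
    (hM : M.IsHermitian) {L : ℝ} (hL : ∀ s ∈ spectrum ℝ M, s ≤ L) (x : Fin n → ℝ) :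
    x ⬝ᵥ (M *ᵥ x) ≤ L * (x ⬝ᵥ x) := by
  have hps : (algebraMap ℝ (Matrix (Fin n) (Fin n) ℝ) L - M).PosSemidef := by
    rw [Matrix.posSemidef_iff_isHermitian_and_spectrum_nonneg]
    refine ⟨?_, ?_⟩
    · rw [Algebra.algebraMap_eq_smul_one]
      refine Matrix.IsHermitian.sub ?_ hM
      rw [Matrix.IsHermitian]
      simp
    · rw [← spectrum.singleton_sub_eq]
      rintro _ ⟨_, rfl, s, hs, rfl⟩
      exact sub_nonneg.mpr (hL s hs)
  have := hps.dotProduct_mulVec_nonneg x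
  rw [Algebra.algebraMap_eq_smul_one, Matrix.sub_mulVec, dotProduct_sub, Matrix.smul_mulVec,
    Matrix.one_mulVec, dotProduct_smul, star_trivial, smul_eq_mul] at this
  linarith

theorem le_dotProduct_mulVec_of_le_spectrum {n : ℕ} {M : Matrix (Fin n) (Fin n) ℝ}
    (hM : M.IsHermitian) {L : ℝ} (hL : ∀ s ∈ spectrum ℝ M, L ≤ s) (x : Fin n → ℝ) :
    L * (x ⬝ᵥ x) ≤ x ⬝ᵥ (M *ᵥ x) := by
  have := dotProduct_mulVec_le_of_spectrum_le hM.neg (L := -L) (fun s hs => by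
    rw [← spectrum.neg_eq] at hs
    have := hL _ hs
    linarith) x
  rw [Matrix.neg_mulVec, dotProduct_neg] at this
  linarith

theorem le_lambdaMax {n : ℕ} {M : Matrix (Fin n) (Fin n) ℝ} {s : ℝ} (hs : s ∈ spectrum ℝ M) :
    s ≤ lambdaMax M :=
  le_csSup M.finite_spectrum.bddAbove hs

theorem spectrum_matP₁ (n : ℕ) : spectrum ℝ (matP₁ n) = spectrum ℝ (matQ₁ n) := by
  have := AlgEquiv.spectrum_eq (Matrix.reindexAlgEquiv ℝ ℝ (Fin.revPerm (n := n))) (matQ₁ n)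
  rw [← this]
  rfl

/-- Because G is its own inverse, G(GᵀG)G = GGᵀ is a similarity. The spectrum of `matQ₁` is
therefore closed under inversion. -/
theorem spectrum_matR (n : ℕ) : spectrum ℝ (matR n) = spectrum ℝ (matQ₁ n) := by
  have hG := signedPascal_mul_self n
  let u : (Matrix (Fin n) (Fin n) ℝ)ˣ := ⟨signedPascal n, signedPascal n, hG, hG⟩
  have := spectrum.units_conjugate (R := ℝ) (a := matQ₁ n) (u := u)
  rw [← this]
  congr 1
  show _ = signedPascal n * matQ₁ n * signedPascal n
  rw [matQ₁, Matrix.mul_assoc, Matrix.mul_assoc, hG, Matrix.mul_one, matR]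

theorem inv_mem_spectrum_matQ₁ {n : ℕ} {s : ℝ} (hs : s ∈ spectrum ℝ (matQ₁ n)) (h0 : s ≠ 0) :
    s⁻¹ ∈ spectrum ℝ (matQ₁ n) := by
  let a : (Matrix (Fin n) (Fin n) ℝ)ˣ := ⟨matQ₁ n, matR n, matQ₁_mul_matR n, matR_mul_matQ₁ n⟩
  have := (spectrum.inv_mem_iff (r := Units.mk0 s h0) (a := a)).mp
    (by simpa [a] using hs)
  rw [← spectrum_matR]
  simpa [a] using this

theorem spectrum_matQ₁_pos {n : ℕ} {s : ℝ} (hs : s ∈ spectrum ℝ (matQ₁ n)) : 0 < s := by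
  have hQ := matQ₁_posDef n
  rw [hQ.isHermitian.spectrum_real_eq_range_eigenvalues] at hs
  obtain ⟨i, rfl⟩ := hs
  exact hQ.eigenvalues_pos i

theorem bigLambda_eq (n : ℕ) : bigLambda n = lambdaMax (matQ₁ n) := by
  rw [bigLambda, matP_one, lambdaMax, spectrum_matP₁, lambdaMax]

theorem bigLambda_nonneg (n : ℕ) : 0 ≤ bigLambda n := by
  rw [bigLambda_eq]
  exact Real.sSup_nonneg fun s hs => (spectrum_matQ₁_pos hs).le

/-- The inversion symmetry makes the smallest eigenvalue at least the reciprocal of the largest, so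
the single number Λ controls the forms from both sides. -/
theorem spectrum_matQ₁_bounds {n : ℕ} {s : ℝ} (hs : s ∈ spectrum ℝ (matQ₁ n)) :
    (bigLambda n)⁻¹ ≤ s ∧ s ≤ bigLambda n := by
  have h0 := spectrum_matQ₁_pos hs
  have h1 := le_lambdaMax (inv_mem_spectrum_matQ₁ hs h0.ne')
  rw [← bigLambda_eq] at h1
  refine ⟨inv_le_of_inv_le₀ h0 h1, ?_⟩
  rw [bigLambda_eq]
  exact le_lambdaMax hs

theorem dotProduct_self_le_of_spectrum {n : ℕ} [NeZero n] {M : Matrix (Fin n) (Fin n) ℝ}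
    (hM : M.IsHermitian) (h : spectrum ℝ M = spectrum ℝ (matQ₁ n)) (x : Fin n → ℝ) :
    x ⬝ᵥ x ≤ bigLambda n * (x ⬝ᵥ (M *ᵥ x)) := by
  have hΛ : 0 < bigLambda n := by
    have hQ := matQ₁_posDef n
    have hm : hQ.isHermitian.eigenvalues 0 ∈ spectrum ℝ (matQ₁ n) :=
      hQ.isHermitian.eigenvalues_mem_spectrum_real 0
    exact (spectrum_matQ₁_pos hm).trans_le (spectrum_matQ₁_bounds hm).2
  have := le_dotProduct_mulVec_of_le_spectrum hM
    (fun s hs => (spectrum_matQ₁_bounds (h ▸ hs)).1) x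
  rwa [inv_mul_le_iff₀ hΛ] at this

theorem dotProduct_self_le_matP₁ {n : ℕ} [NeZero n] (x : Fin n → ℝ) :
    x ⬝ᵥ x ≤ bigLambda n * (x ⬝ᵥ (matP₁ n *ᵥ x)) :=
  dotProduct_self_le_of_spectrum (matP₁_posDef n).isHermitian (spectrum_matP₁ n) x

theorem dotProduct_self_le_matR {n : ℕ} [NeZero n] (x : Fin n → ℝ) :
    x ⬝ᵥ x ≤ bigLambda n * (x ⬝ᵥ (matR n *ᵥ x)) :=
  dotProduct_self_le_of_spectrum (matR_posDef n).isHermitian (spectrum_matR n) x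

theorem dotProduct_matP₁_le {n : ℕ} (x : Fin n → ℝ) :
    x ⬝ᵥ (matP₁ n *ᵥ x) ≤ bigLambda n * (x ⬝ᵥ x) :=
  dotProduct_mulVec_le_of_spectrum_le (matP₁_posDef n).isHermitian
    (fun _ hs => (spectrum_matQ₁_bounds (spectrum_matP₁ n ▸ hs)).2) x

theorem dotProduct_matR_le {n : ℕ} (x : Fin n → ℝ) :
    x ⬝ᵥ (matR n *ᵥ x) ≤ bigLambda n * (x ⬝ᵥ x) :=
  dotProduct_mulVec_le_of_spectrum_le (matR_posDef n).isHermitian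
    (fun _ hs => (spectrum_matQ₁_bounds (spectrum_matR n ▸ hs)).2) x

open scoped MatrixOrder Matrix.Norms.L2Operator in
/-- A symmetric matrix `S` is dominated by `λ_max(S P⁻¹) P` when `P` is positive definite. -/
theorem dotProduct_mulVec_le_lambdaMax_mul {n : ℕ} {P S : Matrix (Fin n) (Fin n) ℝ}
    (hP : P.PosDef) (hS : S.IsHermitian) (x : Fin n → ℝ) :
    x ⬝ᵥ (S *ᵥ x) ≤ lambdaMax (S * P⁻¹) * (x ⬝ᵥ (P *ᵥ x)) := by
  -- With P = BᵀB, the matrix SP⁻¹ is similar to the symmetric B⁻ᵀSB⁻¹; the claim is the Rayleigh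
  -- bound for the latter at the vector Bx.
  obtain ⟨B, hB⟩ := CStarAlgebra.nonneg_iff_eq_star_mul_self.mp hP.posSemidef.nonneg
  rw [Matrix.star_eq_conjTranspose, Matrix.conjTranspose_eq_transpose_of_trivial] at hB
  have hPu := hP.isUnit
  rw [Matrix.isUnit_iff_isUnit_det, hB, Matrix.det_mul, Matrix.det_transpose] at hPu
  have hBd : IsUnit B.det := isUnit_of_mul_isUnit_left hPu
  have h1 : B * B⁻¹ = 1 := Matrix.mul_nonsing_inv B hBd
  have h2 : B⁻¹ * B = 1 := Matrix.nonsing_inv_mul B hBd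
  have h1' : (B⁻¹)ᵀ * Bᵀ = 1 := by rw [← Matrix.transpose_mul, h1, Matrix.transpose_one]
  have h2' : Bᵀ * (B⁻¹)ᵀ = 1 := by rw [← Matrix.transpose_mul, h2, Matrix.transpose_one]
  have hPi : P⁻¹ = B⁻¹ * (B⁻¹)ᵀ := by
    apply Matrix.inv_eq_left_inv
    rw [hB, Matrix.mul_assoc, ← Matrix.mul_assoc _ Bᵀ B, h1', Matrix.one_mul, h2]
  let u : (Matrix (Fin n) (Fin n) ℝ)ˣ := ⟨(B⁻¹)ᵀ, Bᵀ, h1', h2'⟩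
  have hspec := spectrum.units_conjugate (R := ℝ) (a := S * P⁻¹) (u := u)
  have hH : (u : Matrix (Fin n) (Fin n) ℝ) * (S * P⁻¹) * (u⁻¹ : (Matrix (Fin n) (Fin n) ℝ)ˣ)
      = (B⁻¹)ᵀ * S * B⁻¹ := by
    show (B⁻¹)ᵀ * (S * P⁻¹) * Bᵀ = _
    rw [hPi]
    simp only [Matrix.mul_assoc, h1', Matrix.mul_one]
  rw [hH] at hspec
  have hHh : ((B⁻¹)ᵀ * S * B⁻¹).IsHermitian := by
    have := Matrix.isHermitian_conjTranspose_mul_mul B⁻¹ hS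
    rwa [Matrix.conjTranspose_eq_transpose_of_trivial] at this
  have key := dotProduct_mulVec_le_of_spectrum_le hHh
    (fun s hs => le_lambdaMax (hspec ▸ hs)) (B *ᵥ x)
  have e1 : (B *ᵥ x) ⬝ᵥ (((B⁻¹)ᵀ * S * B⁻¹) *ᵥ (B *ᵥ x)) = x ⬝ᵥ (S *ᵥ x) := by
    rw [Matrix.mulVec_mulVec, Matrix.mul_assoc, Matrix.mul_assoc, h2, Matrix.mul_one,
      Matrix.dotProduct_mulVec, Matrix.vecMul_mulVec, ← Matrix.mul_assoc, h2', Matrix.one_mul,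
      ← Matrix.dotProduct_mulVec]
  have e2 : (B *ᵥ x) ⬝ᵥ (B *ᵥ x) = x ⬝ᵥ (P *ᵥ x) := by
    rw [hB, ← Matrix.mulVec_mulVec, Matrix.dotProduct_mulVec x, Matrix.vecMul_transpose]
  rwa [e1, e2] at key

/-- Since (EP + PE)P⁻¹ = E + PEP⁻¹, the constant δ_c/n - 1 is exactly the largest eigenvalue needed.
-/
theorem dotProduct_matE_matP₁_le {n : ℕ} [NeZero n] (x : Fin n → ℝ) :
    x ⬝ᵥ ((matE n * matP₁ n + matP₁ n * matE n) *ᵥ x)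
      ≤ (deltaC n / n - 1) * (x ⬝ᵥ (matP₁ n *ᵥ x)) := by
  have hP := matP₁_posDef n
  have hS : (matE n * matP₁ n + matP₁ n * matE n).IsHermitian := by
    rw [Matrix.IsHermitian, Matrix.conjTranspose_add, Matrix.conjTranspose_mul,
      Matrix.conjTranspose_mul, hP.isHermitian.eq]
    simp [matE, add_comm]
  have key := dotProduct_mulVec_le_lambdaMax_mul hP hS x
  have hn : (n : ℝ) ≠ 0 := Nat.cast_ne_zero.mpr (NeZero.ne n)
  have e : deltaC n / n - 1 =
      lambdaMax ((matE n * matP₁ n + matP₁ n * matE n) * (matP₁ n)⁻¹) := by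
    have hu : IsUnit (matP₁ n).det := (Matrix.isUnit_iff_isUnit_det _).mp hP.isUnit
    rw [deltaC, mul_div_cancel_left₀ _ hn, add_sub_cancel_left, matP_one, Matrix.add_mul,
      Matrix.mul_assoc (matE n), Matrix.mul_nonsing_inv _ hu, Matrix.mul_one]
  rwa [e]

/-- With E_ii = n - 1 - i in zero-based indices, the difference of the two sides is the form with
entries (i + j + 1) R_ij, which is positive semidefinite. -/
theorem dotProduct_matE_matR_le {n : ℕ} (x : Fin n → ℝ) :
    x ⬝ᵥ ((matE n * matR n + matR n * matE n) *ᵥ x)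
      ≤ (2 * (n : ℝ) - 1) * (x ⬝ᵥ (matR n *ᵥ x)) := by
  have key := (weighted_matR_posSemidef n).dotProduct_mulVec_nonneg x
  have e : (Matrix.of fun i j : Fin n => (((i : ℕ) : ℝ) + (j : ℕ) + 1) * matR n i j)
      = (2 * (n : ℝ) - 1) • matR n - (matE n * matR n + matR n * matE n) := by
    ext i j
    simp only [matE, Matrix.sub_apply, Matrix.add_apply, Matrix.smul_apply, Matrix.mul_diagonal,
      Matrix.diagonal_mul, Matrix.of_apply, smul_eq_mul]
    ring
  rw [e, Matrix.sub_mulVec, dotProduct_sub, Matrix.smul_mulVec, dotProduct_smul, star_trivial,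
    smul_eq_mul] at key
  linarith

/-! ### Dissipation inequalities in the rescaled coordinates -/

theorem dotProduct_mulVec_comm_of_isHermitian {n : ℕ} {M : Matrix (Fin n) (Fin n) ℝ}
    (hM : M.IsHermitian) (x y : Fin n → ℝ) : x ⬝ᵥ (M *ᵥ y) = y ⬝ᵥ (M *ᵥ x) := by
  rw [Matrix.dotProduct_mulVec, ← Matrix.mulVec_transpose,
    ← Matrix.conjTranspose_eq_transpose_of_trivial, hM.eq, dotProduct_comm]

theorem two_mul_dotProduct_mulVec_mulVec {n : ℕ} {M : Matrix (Fin n) (Fin n) ℝ}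
    (hM : M.IsHermitian) (N : Matrix (Fin n) (Fin n) ℝ) (x : Fin n → ℝ) :
    2 * (x ⬝ᵥ (M *ᵥ (N *ᵥ x))) = x ⬝ᵥ ((Nᵀ * M + M * N) *ᵥ x) := by
  have h : x ⬝ᵥ ((Nᵀ * M) *ᵥ x) = x ⬝ᵥ (M *ᵥ (N *ᵥ x)) := by
    rw [← Matrix.mulVec_mulVec, Matrix.dotProduct_mulVec, Matrix.vecMul_transpose,
      dotProduct_mulVec_comm_of_isHermitian hM]
  rw [Matrix.add_mulVec, dotProduct_add, h, ← Matrix.mulVec_mulVec]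
  ring

theorem dotProduct_sq_le {n : ℕ} (x y : Fin n → ℝ) : (x ⬝ᵥ y) ^ 2 ≤ (x ⬝ᵥ x) * (y ⬝ᵥ y) := by
  have := Finset.sum_mul_sq_le_sq_mul_sq Finset.univ x y
  simpa only [dotProduct, ← sq] using this

theorem dotProduct_self_nonneg' {n : ℕ} (x : Fin n → ℝ) : 0 ≤ x ⬝ᵥ x :=
  Finset.sum_nonneg fun i _ => mul_self_nonneg (x i)

theorem dotProduct_matR_eq {n : ℕ} (x y : Fin n → ℝ) :
    x ⬝ᵥ (matR n *ᵥ y) = ((signedPascal n)ᵀ *ᵥ x) ⬝ᵥ ((signedPascal n)ᵀ *ᵥ y) := by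
  rw [matR, ← Matrix.mulVec_mulVec, Matrix.dotProduct_mulVec, Matrix.mulVec_transpose _ x]

theorem dotProduct_matR_sq_le {n : ℕ} (x y : Fin n → ℝ) :
    (x ⬝ᵥ (matR n *ᵥ y)) ^ 2 ≤ (x ⬝ᵥ (matR n *ᵥ x)) * (y ⬝ᵥ (matR n *ᵥ y)) := by
  simp only [dotProduct_matR_eq]
  exact dotProduct_sq_le _ _

theorem dotProduct_matP₁_self_nonneg {n : ℕ} (x : Fin n → ℝ) : 0 ≤ x ⬝ᵥ (matP₁ n *ᵥ x) := by
  simpa using (matP₁_posDef n).posSemidef.dotProduct_mulVec_nonneg x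

theorem dotProduct_matR_self_nonneg {n : ℕ} (x : Fin n → ℝ) : 0 ≤ x ⬝ᵥ (matR n *ᵥ x) := by
  simpa using (matR_posDef n).posSemidef.dotProduct_mulVec_nonneg x

/-- The number `c Q P Q cᵀ`. -/
noncomputable def gainQ (n : ℕ) : ℝ :=
  (matQ₁ n *ᵥ vecC n) ⬝ᵥ (matP₁ n *ᵥ (matQ₁ n *ᵥ vecC n))

theorem gainQ_eq (n : ℕ) :
    vecC n ⬝ᵥ ((matQ n 1 * matP n 1 * matQ n 1) *ᵥ vecC n) = gainQ n := by
  rw [matQ_one, matP_one, gainQ, Matrix.mul_assoc, ← Matrix.mulVec_mulVec,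
    ← Matrix.mulVec_mulVec]
  rw [dotProduct_mulVec_comm_of_isHermitian (matQ₁_posDef n).isHermitian, dotProduct_comm]

theorem gainQ_pos (n : ℕ) [NeZero n] : 0 < gainQ n := by
  have h : matQ₁ n *ᵥ vecC n ≠ 0 := by
    intro h
    have h2 := congrArg (matR n *ᵥ ·) h
    simp only [Matrix.mulVec_mulVec, matR_mul_matQ₁, Matrix.one_mulVec, Matrix.mulVec_zero] at h2
    have := congrFun h2 0
    simp [vecC] at this
  simpa [gainQ] using (matP₁_posDef n).dotProduct_mulVec_pos h

theorem transpose_matE (n : ℕ) : (matE n)ᵀ = matE n := Matrix.diagonal_transpose _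

theorem dotProduct_vecMulVec_mulVec {n : ℕ} (b x y : Fin n → ℝ) :
    x ⬝ᵥ (Matrix.vecMulVec b b *ᵥ y) = (b ⬝ᵥ x) * (b ⬝ᵥ y) := by
  rw [Matrix.vecMulVec_mulVec, dotProduct_comm]
  simp [dotProduct_comm, mul_comm]

/-- The Riccati equation gives 2βηᵀP(A - bbᵀP)η = -β ηᵀPη - β(bᵀPη)². Half of this decay is spent on
the injection term βs Qcᵀ. -/
theorem control_dissipation {n : ℕ} [NeZero n] {β : ℝ} (hβ : 0 ≤ β) (η : Fin n → ℝ) (s : ℝ) :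
    2 * (η ⬝ᵥ (matP₁ n *ᵥ (matE n *ᵥ η + β • (shiftA n *ᵥ η)
      - (β * (vecB n ⬝ᵥ (matP₁ n *ᵥ η))) • vecB n + (β * s) • (matQ₁ n *ᵥ vecC n))))
      ≤ (deltaC n / n - 1 - β / 2) * (η ⬝ᵥ (matP₁ n *ᵥ η)) + 2 * β * gainQ n * s ^ 2 := by
  have hPh := (matP₁_posDef n).isHermitian
  have hE := two_mul_dotProduct_mulVec_mulVec hPh (matE n) η
  rw [transpose_matE] at hE
  have hE' := dotProduct_matE_matP₁_le η
  have hA := two_mul_dotProduct_mulVec_mulVec hPh (shiftA n) η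
  have hric := (isControlPLE_matP₁ n).2
  rw [sub_eq_iff_eq_add, one_smul] at hric
  have hbb : η ⬝ᵥ ((matP₁ n * Matrix.vecMulVec (vecB n) (vecB n) * matP₁ n) *ᵥ η)
      = (vecB n ⬝ᵥ (matP₁ n *ᵥ η)) ^ 2 := by
    rw [Matrix.mul_assoc, ← Matrix.mulVec_mulVec, ← Matrix.mulVec_mulVec,
      dotProduct_mulVec_comm_of_isHermitian hPh, dotProduct_comm, dotProduct_vecMulVec_mulVec, sq]
  rw [hric, Matrix.add_mulVec, dotProduct_add, Matrix.neg_mulVec, dotProduct_neg, hbb] at hA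
  have hb : η ⬝ᵥ (matP₁ n *ᵥ vecB n) = vecB n ⬝ᵥ (matP₁ n *ᵥ η) :=
    dotProduct_mulVec_comm_of_isHermitian hPh _ _
  -- Completing the square at 2s Qcᵀ yields 2βs ηᵀPQcᵀ ≤ (β/2) ηᵀPη + 2βq s².
  have hsq := dotProduct_matP₁_self_nonneg (η - (2 * s) • (matQ₁ n *ᵥ vecC n))
  have hc : (matQ₁ n *ᵥ vecC n) ⬝ᵥ (matP₁ n *ᵥ η) = η ⬝ᵥ (matP₁ n *ᵥ (matQ₁ n *ᵥ vecC n)) :=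
    dotProduct_mulVec_comm_of_isHermitian hPh _ _
  simp only [Matrix.mulVec_sub, Matrix.mulVec_add, Matrix.mulVec_smul, dotProduct_sub,
    dotProduct_add, sub_dotProduct, dotProduct_smul, smul_dotProduct, smul_eq_mul, hb, hc]
    at hsq ⊢
  rw [gainQ]
  set a := η ⬝ᵥ (matP₁ n *ᵥ η)
  set w := vecB n ⬝ᵥ (matP₁ n *ᵥ η)
  set r := η ⬝ᵥ (matP₁ n *ᵥ (matQ₁ n *ᵥ vecC n))
  set q := (matQ₁ n *ᵥ vecC n) ⬝ᵥ (matP₁ n *ᵥ (matQ₁ n *ᵥ vecC n))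
  have h1 := mul_nonneg hβ hsq
  have h2 := mul_nonneg hβ (sq_nonneg w)
  have h3 := congrArg (β * ·) hA
  beta_reduce at h3
  nlinarith [h1, h2, h3, hE, hE']

/-- As RQcᵀ = cᵀ, the injection contributes -2β(cε)², while the Lyapunov equation for R returns
+β(cε)². The surplus -β(cε)² is kept to pay for the coupling in `control_dissipation`. -/
theorem observer_dissipation {n : ℕ} (β : ℝ) (ε : Fin n → ℝ) :
    2 * (ε ⬝ᵥ (matR n *ᵥ (matE n *ᵥ ε + β • (shiftA n *ᵥ ε)
      - (β * (vecC n ⬝ᵥ ε)) • (matQ₁ n *ᵥ vecC n))))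
      ≤ (2 * (n : ℝ) - 1 - β) * (ε ⬝ᵥ (matR n *ᵥ ε)) - β * (vecC n ⬝ᵥ ε) ^ 2 := by
  have hRh := (matR_posDef n).isHermitian
  have hE := two_mul_dotProduct_mulVec_mulVec hRh (matE n) ε
  rw [transpose_matE] at hE
  have hE' := dotProduct_matE_matR_le ε
  have hA := two_mul_dotProduct_mulVec_mulVec hRh (shiftA n) ε
  have hric := matR_lyapunov n
  rw [sub_eq_iff_eq_add] at hric
  rw [add_comm (_ * _), hric, Matrix.add_mulVec, dotProduct_add, Matrix.neg_mulVec, dotProduct_neg,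
    dotProduct_vecMulVec_mulVec] at hA
  have hc : matR n *ᵥ (matQ₁ n *ᵥ vecC n) = vecC n := by
    rw [Matrix.mulVec_mulVec, matR_mul_matQ₁, Matrix.one_mulVec]
  simp only [Matrix.mulVec_sub, Matrix.mulVec_add, Matrix.mulVec_smul, dotProduct_sub,
    dotProduct_add, dotProduct_smul, smul_eq_mul, hc, dotProduct_comm ε (vecC n)]
  have h3 := congrArg (β * ·) hA
  beta_reduce at h3
  nlinarith [h3, hE, hE']

/-- Cauchy–Schwarz in the R-inner product; one factor √Λ comes from the R-norm of w, another from
the Euclidean norm of η + ε. -/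
theorem dotProduct_matR_perturbation_le {n : ℕ} [NeZero n] {D : ℝ} (hD : 0 ≤ D)
    {η ε w : Fin n → ℝ} (hw : w ⬝ᵥ w ≤ D ^ 2 * ((η + ε) ⬝ᵥ (η + ε))) :
    |ε ⬝ᵥ (matR n *ᵥ w)| ≤ D * bigLambda n * (√(ε ⬝ᵥ (matR n *ᵥ ε)) *
      (√(η ⬝ᵥ (matP₁ n *ᵥ η)) + √(ε ⬝ᵥ (matR n *ᵥ ε)))) := by
  have hΛ := bigLambda_nonneg n
  have h1 := dotProduct_self_le_matP₁ η
  have h2 := dotProduct_self_le_matR ε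
  have h3 := dotProduct_matR_le w
  have h4 := dotProduct_matR_sq_le ε w
  have hV1 := Real.sq_sqrt (dotProduct_matP₁_self_nonneg η)
  have hV2 := Real.sq_sqrt (dotProduct_matR_self_nonneg ε)
  have ha := Real.sqrt_nonneg (η ⬝ᵥ (matP₁ n *ᵥ η))
  have hb := Real.sqrt_nonneg (ε ⬝ᵥ (matR n *ᵥ ε))
  set a := √(η ⬝ᵥ (matP₁ n *ᵥ η))
  set b := √(ε ⬝ᵥ (matR n *ᵥ ε))
  rw [← hV1] at h1
  rw [← hV2] at h2 h4
  set Λ := bigLambda n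
  have hcross : η ⬝ᵥ ε ≤ Λ * a * b := by
    refine le_of_abs_le (abs_le_of_sq_le_sq ?_ (by positivity))
    calc (η ⬝ᵥ ε) ^ 2 ≤ (η ⬝ᵥ η) * (ε ⬝ᵥ ε) := dotProduct_sq_le _ _
      _ ≤ (Λ * a ^ 2) * (Λ * b ^ 2) :=
        mul_le_mul h1 h2 (dotProduct_self_nonneg' _) (by positivity)
      _ = (Λ * a * b) ^ 2 := by ring
  have hζ : (η + ε) ⬝ᵥ (η + ε) ≤ Λ * (a + b) ^ 2 := by
    rw [add_dotProduct, dotProduct_add, dotProduct_add, dotProduct_comm ε η]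
    nlinarith
  refine abs_le_of_sq_le_sq ?_ (by positivity)
  calc (ε ⬝ᵥ (matR n *ᵥ w)) ^ 2 ≤ b ^ 2 * (w ⬝ᵥ (matR n *ᵥ w)) := h4
    _ ≤ b ^ 2 * (Λ * (D ^ 2 * (Λ * (a + b) ^ 2))) := by
        refine mul_le_mul_of_nonneg_left (h3.trans ?_) (sq_nonneg b)
        exact mul_le_mul_of_nonneg_left (hw.trans (mul_le_mul_of_nonneg_left hζ (sq_nonneg D))) hΛ
    _ = (D * Λ * (b * (a + b))) ^ 2 := by ring

theorem shiftA_mulVec_apply {n : ℕ} (x : Fin n → ℝ) (i : Fin n) :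
    (shiftA n *ᵥ x) i = if h : (i : ℕ) + 1 < n then x ⟨(i : ℕ) + 1, h⟩ else 0 := by
  simp only [Matrix.mulVec, dotProduct, shiftA, Matrix.of_apply]
  split_ifs with h
  · rw [Finset.sum_eq_single ⟨(i : ℕ) + 1, h⟩]
    · simp
    · intro k _ hk
      rw [if_neg (fun h' => hk (Fin.ext h'.symm)), zero_mul]
    · simp
  · refine Finset.sum_eq_zero fun k _ => ?_
    rw [if_neg (by have := k.2; omega), zero_mul]

theorem shiftA_mulVec_dotProduct_self_le {n : ℕ} (x : Fin n → ℝ) :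
    (shiftA n *ᵥ x) ⬝ᵥ (shiftA n *ᵥ x) ≤ x ⬝ᵥ x := by
  rcases n with _ | m
  · simp [dotProduct]
  · simp only [dotProduct, shiftA_mulVec_apply]
    rw [Fin.sum_univ_castSucc, Fin.sum_univ_succ (fun i => x i * x i)]
    have h : ∑ i : Fin m, x i.succ * x i.succ ≤ x 0 * x 0 + ∑ i : Fin m, x i.succ * x i.succ :=
      le_add_of_nonneg_left (mul_self_nonneg (x 0))
    refine le_trans (le_of_eq ?_) h
    simp
    rfl

/-- The Lyapunov function of the scaled closed loop. -/
noncomputable def lyap {n : ℕ} (η ε : Fin n → ℝ) : ℝ :=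
  η ⬝ᵥ (matP₁ n *ᵥ η) + 2 * gainQ n * (ε ⬝ᵥ (matR n *ᵥ ε))

theorem coefD_nonneg {n : ℕ} [NeZero n] (T : ℝ) (c : Fin n → Fin n → ℝ) : 0 ≤ coefD T c :=
  Real.sqrt_nonneg _

theorem beta_pos {n : ℕ} [NeZero n] (T : ℝ) (c : Fin n → Fin n → ℝ) : 0 < beta T c := by
  refine lt_of_lt_of_le ?_ (le_max_right _ _)
  have h1 : (1 : ℝ) ≤ n := by exact_mod_cast NeZero.one_le
  have h2 : 1 / (n : ℝ) ≤ 1 := by rw [div_le_one (by linarith)]; exact h1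
  have h3 := mul_nonneg (mul_nonneg (by positivity : 0 ≤ 4 * √2) (coefD_nonneg T c))
    (bigLambda_nonneg n)
  rw [beta2]
  linarith

/-- The weight 2q of the error form makes the terms 2βq(cε)² cancel. Of the two lower bounds on β,
the first then controls the coefficient of ηᵀPη and the second that of εᵀRε. -/
theorem lyap_dissipation {n : ℕ} [NeZero n] (T : ℝ) (c : Fin n → Fin n → ℝ)
    {η ε v : Fin n → ℝ} (hv : v ⬝ᵥ v ≤ coefD T c ^ 2 * ((η + ε) ⬝ᵥ (η + ε))) :
    2 * (η ⬝ᵥ (matP₁ n *ᵥ (matE n *ᵥ η + beta T c • (shiftA n *ᵥ η)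
      - (beta T c * (vecB n ⬝ᵥ (matP₁ n *ᵥ η))) • vecB n
      + (beta T c * (vecC n ⬝ᵥ ε)) • (matQ₁ n *ᵥ vecC n))))
    + 2 * gainQ n * (2 * (ε ⬝ᵥ (matR n *ᵥ (matE n *ᵥ ε + beta T c • (shiftA n *ᵥ ε)
      - (beta T c * (vecC n ⬝ᵥ ε)) • (matQ₁ n *ᵥ vecC n) + v)))) ≤ -3 * lyap η ε := by
  have hβ := beta_pos T c
  have h1 := control_dissipation hβ.le η (vecC n ⬝ᵥ ε)
  have h2 := observer_dissipation (beta T c) ε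
  have hd := coefD_nonneg T c
  have h3 := le_of_abs_le (dotProduct_matR_perturbation_le hd hv)
  have hq := gainQ_pos n
  have hn : (1 : ℝ) ≤ n := by exact_mod_cast NeZero.one_le
  have hn' : 1 / (n : ℝ) ≤ 1 := by rw [div_le_one (by linarith)]; exact hn
  have hs2 : (1 : ℝ) ≤ √2 := by rw [Real.one_le_sqrt]; norm_num
  have hΛ := bigLambda_nonneg n
  have hb1 : beta1 T c ≤ beta T c := le_max_left _ _
  have hb2 : beta2 T c ≤ beta T c := le_max_right _ _
  rw [beta1, gainQ_eq] at hb1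
  rw [beta2] at hb2
  rw [lyap]
  have hV1 := Real.sq_sqrt (dotProduct_matP₁_self_nonneg η)
  have hV2 := Real.sq_sqrt (dotProduct_matR_self_nonneg ε)
  rw [Matrix.mulVec_add _ _ v, dotProduct_add]
  set X := ε ⬝ᵥ (matR n *ᵥ (matE n *ᵥ ε + beta T c • (shiftA n *ᵥ ε)
      - (beta T c * (vecC n ⬝ᵥ ε)) • (matQ₁ n *ᵥ vecC n)))
  set Y := η ⬝ᵥ (matP₁ n *ᵥ (matE n *ᵥ η + beta T c • (shiftA n *ᵥ η)
      - (beta T c * (vecB n ⬝ᵥ (matP₁ n *ᵥ η))) • vecB n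
      + (beta T c * (vecC n ⬝ᵥ ε)) • (matQ₁ n *ᵥ vecC n)))
  set a := √(η ⬝ᵥ (matP₁ n *ᵥ η))
  set b := √(ε ⬝ᵥ (matR n *ᵥ ε))
  rw [← hV1] at h1 ⊢
  rw [← hV2] at h2 ⊢
  set Λ := bigLambda n
  set d := coefD T c
  set q := gainQ n
  set β := beta T c
  set s := vecC n ⬝ᵥ ε
  set δ := deltaC n / n
  have hdΛ : 0 ≤ d * Λ := mul_nonneg hd hΛ
  -- Of the factor √2 n only √2 n ≥ 1 is needed.
  have hb1' : 8 * (q * (d * Λ)) + 2 * (2 + δ) ≤ β := by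
    have : 1 * 1 ≤ √2 * n := mul_le_mul hs2 hn zero_le_one (by positivity)
    have h := mul_le_mul_of_nonneg_right this (mul_nonneg hq.le hdΛ)
    nlinarith
  have hb2' : 4 * (d * Λ) + 4 * n + 2 ≤ β := by
    have h := mul_le_mul_of_nonneg_right hs2 hdΛ
    nlinarith
  have ha2 : 0 ≤ a ^ 2 := sq_nonneg a
  have hb2n : 0 ≤ b ^ 2 := sq_nonneg b
  have e1 : (δ - 1 - β / 2) * a ^ 2 ≤ (-3 - 4 * (q * (d * Λ))) * a ^ 2 :=
    mul_le_mul_of_nonneg_right (by linarith) ha2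
  have e2 : (2 * (n : ℝ) - 1 - β) * b ^ 2 ≤ (-3 - 4 * (d * Λ)) * b ^ 2 :=
    mul_le_mul_of_nonneg_right (by linarith) hb2n
  have e3 : 2 * q * (2 * (X + ε ⬝ᵥ (matR n *ᵥ v))) ≤
      2 * q * ((-3 - 4 * (d * Λ)) * b ^ 2 - β * s ^ 2 + 2 * (d * Λ * (b * (a + b)))) :=
    mul_le_mul_of_nonneg_left (by linarith) (by linarith)
  -- Splits the mixed term ab coming from the nonlinearity between a² and b².
  have e4 : 0 ≤ (q * (d * Λ)) * (a - b) ^ 2 := by positivity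
  have e5 : 0 ≤ (q * (d * Λ)) * a ^ 2 := by positivity
  have e6 : 0 ≤ (q * (d * Λ)) * b ^ 2 := by positivity
  nlinarith

/-- The growth rate of the Lyapunov function caused by a coupling `κ A`. -/
noncomputable def growthK (n : ℕ) : ℝ := (2 * gainQ n + 3) * bigLambda n

theorem growthK_nonneg (n : ℕ) [NeZero n] : 0 ≤ growthK n :=
  mul_nonneg (by linarith [gainQ_pos n]) (bigLambda_nonneg n)

theorem lyap_nonneg {n : ℕ} [NeZero n] (η ε : Fin n → ℝ) : 0 ≤ lyap η ε := by
  have := dotProduct_matP₁_self_nonneg η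
  have := mul_nonneg (gainQ_pos n).le (dotProduct_matR_self_nonneg ε)
  rw [lyap]
  linarith

/-- Handles the part of u₀ that is not βs. The shift is a contraction, so the perturbation estimate
applies with D = 1; after ab ≤ (a² + b²)/2 the coefficients are 2qΛ on a² and 6qΛ on b², which
explains the constant 2q + 3. -/
theorem lyap_coupling_le {n : ℕ} [NeZero n] (η ε : Fin n → ℝ) :
    2 * gainQ n * (2 * |ε ⬝ᵥ (matR n *ᵥ (shiftA n *ᵥ (η + ε)))|) ≤ growthK n * lyap η ε := by
  have h3 := dotProduct_matR_perturbation_le (η := η) (ε := ε) (w := shiftA n *ᵥ (η + ε))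
    zero_le_one (by simpa using shiftA_mulVec_dotProduct_self_le (η + ε))
  have hq := gainQ_pos n
  have hΛ := bigLambda_nonneg n
  rw [lyap, growthK]
  have hV1 := Real.sq_sqrt (dotProduct_matP₁_self_nonneg η)
  have hV2 := Real.sq_sqrt (dotProduct_matR_self_nonneg ε)
  set a := √(η ⬝ᵥ (matP₁ n *ᵥ η))
  set b := √(ε ⬝ᵥ (matR n *ᵥ ε))
  rw [← hV1, ← hV2]
  set Λ := bigLambda n
  set q := gainQ n
  have e1 := mul_le_mul_of_nonneg_left h3 (by linarith : 0 ≤ 4 * q)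
  have e2 : 0 ≤ (q * Λ) * (a - b) ^ 2 := by positivity
  have e3 : 0 ≤ Λ * a ^ 2 := by positivity
  have e4 : 0 ≤ q * q * Λ * b ^ 2 := by positivity
  nlinarith

/-! ### Rescaling of the closed loop -/

theorem gam_eq {T : ℝ} (hT : 0 < T) (t : ℝ) : gam T t = (T - t)⁻¹ := by
  rw [gam, mul_one_div, div_right_comm, div_self hT.ne', one_div]

theorem vecC_dotProduct {n : ℕ} [NeZero n] (x : Fin n → ℝ) : vecC n ⬝ᵥ x = x 0 := by
  rw [dotProduct, Finset.sum_eq_single 0]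
  · simp [vecC]
  · intro i _ hi
    rw [vecC, if_neg (fun h => hi (Fin.ext (by simpa using h))), zero_mul]
  · simp

theorem mulVec_vecC {n : ℕ} [NeZero n] (M : Matrix (Fin n) (Fin n) ℝ) (i : Fin n) :
    (M *ᵥ vecC n) i = M i 0 := by
  rw [Matrix.mulVec, dotProduct_comm, vecC_dotProduct]

/-- The weighted state with components `g^(n-i) x_i` (indices `1, …, n`). -/
def rescale {n : ℕ} (g : ℝ) (x : Fin n → ℝ) : Fin n → ℝ := fun i => g ^ (i.rev : ℕ) * x i

theorem matE_mulVec {n : ℕ} (x : Fin n → ℝ) (i : Fin n) :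
    (matE n *ᵥ x) i = ((i.rev : ℕ) : ℝ) * x i := by
  rw [matE, Matrix.mulVec_diagonal, Fin.val_rev, Nat.cast_sub i.2]
  push_cast
  ring

theorem shiftA_mulVec_rescale {n : ℕ} (g : ℝ) (x : Fin n → ℝ) (i : Fin n) :
    g * (shiftA n *ᵥ rescale g x) i = g ^ (i.rev : ℕ) * (shiftA n *ᵥ x) i := by
  rw [shiftA_mulVec_apply, shiftA_mulVec_apply]
  split_ifs with h
  · rw [rescale, ← mul_assoc, ← pow_succ']
    congr 2
    simp only [Fin.val_rev]
    omega
  · simp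

theorem vecB_dotProduct_matP_mulVec {n : ℕ} [NeZero n] {g : ℝ} (hg : 0 < g) (x : Fin n → ℝ) :
    vecB n ⬝ᵥ (matP n g *ᵥ x) = g * (vecB n ⬝ᵥ (matP₁ n *ᵥ rescale g x)) := by
  simp only [dotProduct, Matrix.mulVec, Finset.mul_sum]
  refine Finset.sum_congr rfl fun i _ => Finset.sum_congr rfl fun j _ => ?_
  rw [matP_apply n hg, rescale, vecB]
  split_ifs with h
  · rw [show (i.rev : ℕ) = 0 by rw [Fin.val_rev]; omega]
    ring
  · simp

theorem control_eq {n : ℕ} [NeZero n] {T : ℝ} (hT : 0 < T) (β : ℝ) {t : ℝ} (ht : t < T)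
    (ξ : EuclideanSpace ℝ (Fin n)) :
    control T β t ξ =
      -(β * (T - t)⁻¹ * (vecB n ⬝ᵥ (matP₁ n *ᵥ rescale (T - t)⁻¹ ξ.ofLp))) := by
  rw [control, gam_eq hT, vecB_dotProduct_matP_mulVec (inv_pos.mpr (sub_pos.mpr ht))]
  ring

theorem pow_rev_mul_vecB {n : ℕ} (g : ℝ) (i : Fin n) : g ^ (i.rev : ℕ) * vecB n i = vecB n i := by
  rw [vecB]
  split_ifs with h
  · rw [show (i.rev : ℕ) = 0 by rw [Fin.val_rev]; omega]
    simp
  · simp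

theorem rescale_observerField {n : ℕ} [NeZero n] {T : ℝ} (hT : 0 < T) (β : ℝ) {t : ℝ} (ht : t < T)
    (x₀ : ℝ) (x ξ : EuclideanSpace ℝ (Fin n)) (i : Fin n) :
    ((T - t)⁻¹) ^ (i.rev : ℕ) * observerField T β t (control T β t ξ) (output x₀ x) ξ i =
      (T - t)⁻¹ * (β • (shiftA n *ᵥ rescale (T - t)⁻¹ ξ.ofLp)
        - (β * (vecB n ⬝ᵥ (matP₁ n *ᵥ rescale (T - t)⁻¹ ξ.ofLp))) • vecB n
        + (β * (vecC n ⬝ᵥ (rescale ((T - t)⁻¹ ^ 2) x.ofLp - rescale (T - t)⁻¹ ξ.ofLp))) •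
          (matQ₁ n *ᵥ vecC n)) i := by
  have hg : 0 < (T - t)⁻¹ := inv_pos.mpr (sub_pos.mpr ht)
  rw [observerField, output, control_eq hT β ht, gam_eq hT, mulVec_vecC, matQ_apply n hg,
    vecC_dotProduct]
  simp only [Pi.add_apply, Pi.sub_apply, Pi.smul_apply, smul_eq_mul, vecC_dotProduct, mulVec_vecC]
  set g := (T - t)⁻¹
  have h1 := shiftA_mulVec_rescale g ξ.ofLp i
  have h2 := pow_rev_mul_vecB g i
  -- The weight g^(n-1-i) times the gain factor g^(i+1) is g^n. One g is the common time factor; the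
  -- remaining g^(n-1) turns the innovation into cζ - cη.
  have h3 : g ^ (i.rev : ℕ) * g ^ ((i : ℕ) + ((0 : Fin n) : ℕ) + 1) = g * g ^ (n - 1) := by
    rw [← pow_add, ← pow_succ']
    congr 1
    have := i.2
    simp only [Fin.val_rev, Fin.val_zero]
    omega
  have h4 : rescale (g ^ 2) x.ofLp 0 - rescale g ξ.ofLp 0
      = g ^ (n - 1) * (g ^ (n - 1) * x 0 - ξ 0) := by
    simp only [rescale, Fin.val_rev, Fin.val_zero, zero_add]
    ring
  rw [h4]
  linear_combination β * (-h1) + (-(β * g * (vecB n ⬝ᵥ (matP₁ n *ᵥ rescale g ξ.ofLp)))) * h2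
    + (β * matQ₁ n i 0 * (g ^ (n - 1) * x 0 - ξ 0)) * h3

/-- The scaled nonlinearity of the plant. -/
noncomputable def scaledNonlinearity {n : ℕ} (s : ℝ) (f : Fin n → ℝ) (x : Fin n → ℝ) : Fin n → ℝ :=
  fun i => ((i.rev : ℕ) : ℝ) * rescale (s⁻¹ ^ 2) x i + s * ((s⁻¹ ^ 2) ^ (i.rev : ℕ) * f i)

/-- With u₀ in closed form, its part βs reproduces the term (β/s)A of the observer, and its part of
order s² leaves the bounded coupling -3κA. The extra summand on the left is one of the two copies of
Eζ/s produced by differentiating the weights; it is stored in `scaledNonlinearity`. -/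
theorem rescale_plantField {n : ℕ} [NeZero n] {T : ℝ} (hT : 0 < T) (β κ : ℝ) {t : ℝ} (ht : t < T)
    (φ : Fin n → ℝ → ℝ → EuclideanSpace ℝ (Fin n) → ℝ) (x ξ : EuclideanSpace ℝ (Fin n))
    (i : Fin n) :
    ((T - t)⁻¹ ^ 2) ^ (i.rev : ℕ) * plantField φ t ((T - t) * (β - 3 * (T - t) * κ))
        (control T β t ξ) x i + ((i.rev : ℕ) : ℝ) * (T - t)⁻¹ * rescale ((T - t)⁻¹ ^ 2) x.ofLp i =
      (T - t)⁻¹ * (β • (shiftA n *ᵥ rescale ((T - t)⁻¹ ^ 2) x.ofLp)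
        - (β * (vecB n ⬝ᵥ (matP₁ n *ᵥ rescale (T - t)⁻¹ ξ.ofLp))) • vecB n
        + scaledNonlinearity (T - t) (fun i => φ i t (control T β t ξ) x) x.ofLp) i
        + (-3 * κ) * (shiftA n *ᵥ rescale ((T - t)⁻¹ ^ 2) x.ofLp) i := by
  have hs : T - t ≠ 0 := (sub_pos.mpr ht).ne'
  have h1 := shiftA_mulVec_rescale ((T - t)⁻¹ ^ 2) x.ofLp i
  have h2 := pow_rev_mul_vecB ((T - t)⁻¹ ^ 2) i
  simp only [Pi.add_apply, Pi.sub_apply, Pi.smul_apply, smul_eq_mul, scaledNonlinearity]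
  have hf : plantField φ t ((T - t) * (β - 3 * (T - t) * κ)) (control T β t ξ) x i =
      (T - t) * (β - 3 * (T - t) * κ) * (shiftA n *ᵥ x.ofLp) i + vecB n i * control T β t ξ
        + φ i t (control T β t ξ) x := by
    rw [plantField, shiftA_mulVec_apply, vecB]
    have := i.2
    by_cases h : (i : ℕ) + 1 < n
    · rw [dif_pos h, dif_pos h, if_neg h.ne]
      ring
    · rw [dif_neg h, dif_neg h, if_pos (by omega)]
      ring
  rw [hf]
  have hu := control_eq hT β ht ξ
  set U := control T β t ξ
  set s := T - t
  have hss : s⁻¹ * s = 1 := inv_mul_cancel₀ hs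
  set g := s⁻¹
  set a := (shiftA n *ᵥ rescale (g ^ 2) x.ofLp) i
  set w := vecB n ⬝ᵥ (matP₁ n *ᵥ rescale g ξ.ofLp)
  set p := (g ^ 2) ^ (i.rev : ℕ)
  have e1 : p * (s * (β - 3 * s * κ) * (shiftA n *ᵥ x.ofLp) i) = g * β * a - 3 * κ * a := by
    calc _ = s * (β - 3 * s * κ) * (p * (shiftA n *ᵥ x.ofLp) i) := by ring
      _ = (g * s) * (β - 3 * s * κ) * g * a := by rw [← h1]; ring
      _ = _ := by linear_combination (β * g * a - 3 * κ * a * (g * s + 1)) * hss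
  linear_combination e1 + U * h2 + vecB n i * hu
    - p * φ i t U x * hss

theorem hasDerivWithinAt_inv_sub {T t : ℝ} (ht : t < T) (S : Set ℝ) :
    HasDerivWithinAt (fun s => (T - s)⁻¹) ((T - t)⁻¹ ^ 2) S t := by
  have h := ((hasDerivAt_id t).const_sub T).inv (sub_pos.mpr ht).ne'
  refine (h.congr_deriv ?_).hasDerivWithinAt
  simp [inv_pow]

theorem hasDerivWithinAt_rescale {n : ℕ} {T t : ℝ} (ht : t < T) {S : Set ℝ} (m : ℕ)
    {x : ℝ → Fin n → ℝ} {i : Fin n} {x' : ℝ}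
    (hx : HasDerivWithinAt (fun s => x s i) x' S t) :
    HasDerivWithinAt (fun s => rescale ((T - s)⁻¹ ^ m) (x s) i)
      (((T - t)⁻¹ ^ m) ^ (i.rev : ℕ) * x' +
        (m * (i.rev : ℕ) : ℝ) * (T - t)⁻¹ * rescale ((T - t)⁻¹ ^ m) (x t) i) S t := by
  have h := ((hasDerivWithinAt_inv_sub ht S).pow (m * (i.rev : ℕ))).mul hx
  refine HasDerivWithinAt.congr_deriv (f := fun s => rescale ((T - s)⁻¹ ^ m) (x s) i)
    (h.congr_of_eventuallyEq ?_ ?_) ?_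
  · exact Filter.Eventually.of_forall fun s => by simp [rescale, pow_mul]
  · simp [rescale, pow_mul]
  · simp only [rescale, Pi.pow_apply, ← pow_mul]
    -- The power rule contains the truncated exponent m(n-1-i) - 1, so a zero exponent is treated
    -- apart.
    rcases Nat.eq_zero_or_pos (m * (i.rev : ℕ)) with h0 | h0
    · have h0' : (m : ℝ) * ((i.rev : ℕ) : ℝ) = 0 := by exact_mod_cast h0
      rw [h0, h0']
      simp
    · obtain ⟨k, hk⟩ := Nat.exists_eq_succ_of_ne_zero h0.ne'
      have hk' : (m : ℝ) * ((i.rev : ℕ) : ℝ) = k + 1 := by exact_mod_cast hk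
      rw [hk, hk']
      push_cast
      simp only [Nat.succ_eq_add_one]
      ring

theorem hasDerivWithinAt_dotProduct_mulVec {n : ℕ} {M : Matrix (Fin n) (Fin n) ℝ}
    (hM : M.IsHermitian) {S : Set ℝ} {t : ℝ} {f : ℝ → Fin n → ℝ} {f' : Fin n → ℝ}
    (hf : ∀ i, HasDerivWithinAt (fun s => f s i) (f' i) S t) :
    HasDerivWithinAt (fun s => f s ⬝ᵥ (M *ᵥ f s)) (2 * (f t ⬝ᵥ (M *ᵥ f'))) S t := by
  have h : HasDerivWithinAt (fun s => f s ⬝ᵥ (M *ᵥ f s))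
      (∑ i, (f' i * (M *ᵥ f t) i + f t i * (M *ᵥ f') i)) S t := by
    refine HasDerivWithinAt.fun_sum fun i _ => (hf i).mul ?_
    exact HasDerivWithinAt.fun_sum (u := Finset.univ) fun j _ => (hf j).const_mul (M i j)
  refine h.congr_deriv ?_
  rw [Finset.sum_add_distrib]
  have := dotProduct_mulVec_comm_of_isHermitian hM f' (f t)
  simp only [dotProduct] at this ⊢
  rw [this]
  ring

/-! ### Bound on the scaled nonlinearity -/

/-- At the j-th unit vector the growth bound collapses to c_ij, which dominates an absolute value.
-/
theorem Admissible.coef_nonneg {n : ℕ} {T : ℝ} (hT : 0 < T) {c : Fin n → Fin n → ℝ}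
    {φ : Fin n → ℝ → ℝ → EuclideanSpace ℝ (Fin n) → ℝ} (h : Admissible T c φ) {i j : Fin n}
    (hij : j ≤ i) : 0 ≤ c i j := by
  have := h.2 i 0 ⟨le_rfl, hT⟩ 0 (EuclideanSpace.single j 1)
  rw [Finset.sum_eq_single j] at this
  · simpa using (abs_nonneg _).trans this
  · intro k _ hk
    simp [hk]
  · intro hj
    exact absurd (Finset.mem_Iic.mpr hij) hj

theorem coefD_sq_ge {n : ℕ} [NeZero n] {T : ℝ} (c : Fin n → Fin n → ℝ) (j : Fin n) :
    ∑ i ∈ Finset.Ici j, coefG T c i j ^ 2 * (((i : ℕ) : ℝ) + 1) / (1 / T) ^ (2 * ((i : ℕ) - (j : ℕ)))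
      ≤ coefD T c ^ 2 := by
  have h := Finset.le_sup' (fun j : Fin n => ∑ i ∈ Finset.Ici j,
    coefG T c i j ^ 2 * (((i : ℕ) : ℝ) + 1) / (1 / T) ^ (2 * ((i : ℕ) - (j : ℕ))))
    (Finset.mem_univ j)
  rw [coefD, Real.sq_sqrt]
  · exact h
  · refine le_trans (Finset.sum_nonneg fun i _ => ?_) h
    rw [pow_mul]
    positivity

/-- The weights leave c_ij s^(2(i-j)+1), and s ≤ T. The power of T splits into the T^(i-j+1) inside
g_ij and a factor T^(i-j) = γ₀^(-(i-j)); on the diagonal n - i enters from the stored copy of Eζ. -/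
theorem abs_scaledNonlinearity_le {n : ℕ} {T s : ℝ} (hs : 0 < s) (hsT : s ≤ T)
    {c : Fin n → Fin n → ℝ} {f x : Fin n → ℝ} (hc : ∀ i j, j ≤ i → 0 ≤ c i j)
    (hf : ∀ i, |f i| ≤ ∑ j ∈ Finset.Iic i, c i j * |x j|) (i : Fin n) :
    |scaledNonlinearity s f x i| ≤ ∑ j ∈ Finset.Iic i,
      (coefG T c i j * T ^ ((i : ℕ) - (j : ℕ))) * |rescale (s⁻¹ ^ 2) x j| := by
  have hT : 0 < T := hs.trans_le hsT
  have h1 : |scaledNonlinearity s f x i| ≤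
      ((i.rev : ℕ) : ℝ) * |rescale (s⁻¹ ^ 2) x i| + ∑ j ∈ Finset.Iic i,
        c i j * T ^ (2 * ((i : ℕ) - (j : ℕ)) + 1) * |rescale (s⁻¹ ^ 2) x j| := by
    refine (abs_add_le _ _).trans (add_le_add (le_of_eq ?_) ?_)
    · rw [abs_mul, Nat.abs_cast]
    · rw [abs_mul, abs_mul, abs_of_pos hs, abs_of_pos (by positivity : 0 < (s⁻¹ ^ 2) ^ (i.rev : ℕ))]
      refine (mul_le_mul_of_nonneg_left (mul_le_mul_of_nonneg_left (hf i) (by positivity))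
        hs.le).trans ?_
      rw [Finset.mul_sum, Finset.mul_sum]
      refine Finset.sum_le_sum fun j hj => ?_
      have hji := Finset.mem_Iic.mp hj
      rw [rescale, abs_mul, abs_of_pos (by positivity : 0 < (s⁻¹ ^ 2) ^ (j.rev : ℕ))]
      have hk : (j.rev : ℕ) = (i.rev : ℕ) + ((i : ℕ) - (j : ℕ)) := by
        have : (j : ℕ) ≤ i := hji
        have := i.2
        simp only [Fin.val_rev]
        omega
      have e : s * ((s⁻¹ ^ 2) ^ (i.rev : ℕ) * (c i j * |x j|)) =
          c i j * s ^ (2 * ((i : ℕ) - (j : ℕ)) + 1) * ((s⁻¹ ^ 2) ^ (j.rev : ℕ) * |x j|) := by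
        rw [hk, pow_add (s⁻¹ ^ 2), pow_succ s, pow_mul s]
        have : (s ^ 2) ^ ((i : ℕ) - (j : ℕ)) * (s⁻¹ ^ 2) ^ ((i : ℕ) - (j : ℕ)) = 1 := by
          rw [← mul_pow, ← mul_pow, mul_inv_cancel₀ hs.ne', one_pow, one_pow]
        linear_combination (-(c i j * |x j| * s * (s⁻¹ ^ 2) ^ (i.rev : ℕ))) * this
      rw [e]
      refine mul_le_mul_of_nonneg_right (mul_le_mul_of_nonneg_left ?_ (hc i j hji)) (by positivity)
      exact pow_le_pow_left₀ hs.le hsT _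
  refine h1.trans (le_of_eq ?_)
  have hi : i ∈ Finset.Iic i := Finset.mem_Iic.mpr le_rfl
  rw [← Finset.add_sum_erase _ _ hi, ← Finset.add_sum_erase _ _ hi, ← add_assoc]
  congr 1
  · rw [coefG, if_pos rfl, Fin.val_rev, Nat.cast_sub i.2]
    push_cast
    simp
    ring
  · refine Finset.sum_congr rfl fun j hj => ?_
    obtain ⟨hne, hj⟩ := Finset.mem_erase.mp hj
    have hji : j ≤ i := Finset.mem_Iic.mp hj
    have : (j : ℕ) ≤ i := hji
    rw [coefG, if_neg hne, mul_assoc (c i j) (T ^ _) (T ^ _), ← pow_add]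
    congr 3
    omega

/-- Cauchy–Schwarz in each row gives the factor i, the number of its terms; exchanging the sums
leaves the column sums whose maximum is d². -/
theorem scaledNonlinearity_dotProduct_self_le {n : ℕ} [NeZero n] {T s : ℝ} (hs : 0 < s)
    (hsT : s ≤ T) {c : Fin n → Fin n → ℝ} {f x : Fin n → ℝ} (hc : ∀ i j, j ≤ i → 0 ≤ c i j)
    (hf : ∀ i, |f i| ≤ ∑ j ∈ Finset.Iic i, c i j * |x j|) :
    scaledNonlinearity s f x ⬝ᵥ scaledNonlinearity s f x ≤
      coefD T c ^ 2 * (rescale (s⁻¹ ^ 2) x ⬝ᵥ rescale (s⁻¹ ^ 2) x) := by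
  set z := rescale (s⁻¹ ^ 2) x
  have hT : 0 < T := hs.trans_le hsT
  have h1 : ∀ i, scaledNonlinearity s f x i * scaledNonlinearity s f x i ≤
      ∑ j ∈ Finset.Iic i, coefG T c i j ^ 2 * (((i : ℕ) : ℝ) + 1) /
        (1 / T) ^ (2 * ((i : ℕ) - (j : ℕ))) * z j ^ 2 := by
    intro i
    have h := abs_scaledNonlinearity_le hs hsT hc hf i
    have h2 := pow_le_pow_left₀ (abs_nonneg _) h 2
    rw [sq_abs, sq] at h2
    refine h2.trans ((sq_sum_le_card_mul_sum_sq).trans (le_of_eq ?_))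
    rw [Fin.card_Iic, Finset.mul_sum]
    refine Finset.sum_congr rfl fun j _ => ?_
    rw [mul_pow, sq_abs, mul_pow, one_div, inv_pow T, div_inv_eq_mul, mul_comm 2 ((i : ℕ) - j),
      pow_mul]
    push_cast
    ring
  calc scaledNonlinearity s f x ⬝ᵥ scaledNonlinearity s f x
      ≤ ∑ i, ∑ j ∈ Finset.Iic i, coefG T c i j ^ 2 * (((i : ℕ) : ℝ) + 1) /
        (1 / T) ^ (2 * ((i : ℕ) - (j : ℕ))) * z j ^ 2 := Finset.sum_le_sum fun i _ => h1 i
    _ = ∑ j, ∑ i ∈ Finset.Ici j, coefG T c i j ^ 2 * (((i : ℕ) : ℝ) + 1) /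
        (1 / T) ^ (2 * ((i : ℕ) - (j : ℕ))) * z j ^ 2 := by
        refine Finset.sum_comm' fun i j => ?_
        simp
    _ ≤ ∑ j, coefD T c ^ 2 * (z j * z j) := by
        refine Finset.sum_le_sum fun j _ => ?_
        rw [← Finset.sum_mul, ← sq]
        exact mul_le_mul_of_nonneg_right (coefD_sq_ge c j) (sq_nonneg _)
    _ = coefD T c ^ 2 * (z ⬝ᵥ z) := by rw [← Finset.mul_sum]; rfl

/-! ### Explicit solution of the x₀-equation -/

section ClosedLoop

variable {n : ℕ} [NeZero n] {T β τ : ℝ} {φ : Fin n → ℝ → ℝ → EuclideanSpace ℝ (Fin n) → ℝ}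
  {x₀ : ℝ → ℝ} {x ξ : ℝ → EuclideanSpace ℝ (Fin n)} {u₀ u : ℝ → ℝ}

/-- The quantity (x₀ + (β/2)(T-t)²)/(T-t)³ has zero derivative along every solution. -/
theorem IsClosedLoop.x₀_eq (hT : 0 < T) (hτ : τ ≤ T) (h : IsClosedLoop T β φ τ x₀ x ξ u₀ u)
    {t : ℝ} (ht : t ∈ Set.Ico 0 τ) :
    x₀ t = (T - t) ^ 3 * (x₀ 0 / T ^ 3 + β / (2 * T)) - β / 2 * (T - t) ^ 2 := by
  have hd : ∀ s ∈ Set.Ico 0 τ, HasDerivWithinAt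
      (fun s => (x₀ s + β / 2 * (T - s) ^ 2) * ((T - s)⁻¹) ^ 3) 0 (Set.Ico 0 τ) s := by
    intro s hs
    have hsT : s < T := hs.2.trans_le hτ
    have hne : T - s ≠ 0 := (sub_pos.mpr hsT).ne'
    have h1 := h.deriv_x₀ s hs
    rw [h.eq_u₀ s hs, control0, output] at h1
    have h2 := (((hasDerivAt_id s).const_sub T).pow 2).hasDerivWithinAt (s := Set.Ico 0 τ)
    have h3 := (h1.add (h2.const_mul (β / 2))).mul ((hasDerivWithinAt_inv_sub hsT (Set.Ico 0 τ)).pow 3)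
    refine h3.congr_deriv ?_
    simp
    field_simp
    ring
  have h0 : (0 : ℝ) ∈ Set.Ico 0 τ := ⟨le_rfl, ht.1.trans_lt ht.2⟩
  have hc := (convex_Ico 0 τ).norm_image_sub_le_of_norm_hasDerivWithin_le (C := 0) hd
    (fun s _ => by simp) h0 ht
  rw [zero_mul, norm_le_zero_iff, sub_eq_zero] at hc
  have hne : T - t ≠ 0 := (sub_pos.mpr (ht.2.trans_le hτ)).ne'
  have hT' := hT.ne'
  rw [sub_zero] at hc
  field_simp at hc ⊢
  linear_combination hc

theorem IsClosedLoop.u₀_eq (hT : 0 < T) (hτ : τ ≤ T) (h : IsClosedLoop T β φ τ x₀ x ξ u₀ u)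
    {t : ℝ} (ht : t ∈ Set.Ico 0 τ) :
    u₀ t = (T - t) * (β - 3 * (T - t) * (x₀ 0 / T ^ 3 + β / (2 * T))) := by
  have hne : T - t ≠ 0 := (sub_pos.mpr (ht.2.trans_le hτ)).ne'
  rw [h.eq_u₀ t ht, control0, output, h.x₀_eq hT hτ ht]
  field_simp
  ring

end ClosedLoop

/-! ### Decay of the Lyapunov function along solutions -/

section Lyapunov

variable {n : ℕ} [NeZero n] {T τ : ℝ} {c : Fin n → Fin n → ℝ}
  {φ : Fin n → ℝ → ℝ → EuclideanSpace ℝ (Fin n) → ℝ}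
  {x₀ : ℝ → ℝ} {x ξ : ℝ → EuclideanSpace ℝ (Fin n)} {u₀ u : ℝ → ℝ}

/-- The Lyapunov function along a trajectory. -/
noncomputable def lyapAlong (T : ℝ) (x ξ : ℝ → EuclideanSpace ℝ (Fin n)) (t : ℝ) : ℝ :=
  lyap (rescale ((T - t)⁻¹ ^ 1) (ξ t).ofLp)
    (rescale ((T - t)⁻¹ ^ 2) (x t).ofLp - rescale ((T - t)⁻¹ ^ 1) (ξ t).ofLp)

theorem IsClosedLoop.lyapAlong_deriv (hT : 0 < T) (hτ : τ ≤ T) (hφ : Admissible T c φ)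
    (h : IsClosedLoop T (beta T c) φ τ x₀ x ξ u₀ u) {t : ℝ} (ht : t ∈ Set.Ico 0 τ) :
    ∃ L', HasDerivWithinAt (lyapAlong T x ξ) L' (Set.Ico 0 τ) t ∧
      L' ≤ (-3 * (T - t)⁻¹ + 3 * |x₀ 0 / T ^ 3 + beta T c / (2 * T)| * growthK n) *
        lyapAlong T x ξ t := by
  have htT : t < T := ht.2.trans_le hτ
  have hs : 0 < T - t := sub_pos.mpr htT
  set κ := x₀ 0 / T ^ 3 + beta T c / (2 * T)
  set β := beta T c
  set η := rescale ((T - t)⁻¹ ^ 1) (ξ t).ofLp with hη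
  set ζ := rescale ((T - t)⁻¹ ^ 2) (x t).ofLp with hζ
  set v := scaledNonlinearity (T - t) (fun i => φ i t (u t) (x t)) (x t).ofLp with hv
  set η' : Fin n → ℝ := matE n *ᵥ η + β • (shiftA n *ᵥ η)
      - (β * (vecB n ⬝ᵥ (matP₁ n *ᵥ η))) • vecB n
      + (β * (vecC n ⬝ᵥ (ζ - η))) • (matQ₁ n *ᵥ vecC n) with hη'
  set ε' : Fin n → ℝ := matE n *ᵥ (ζ - η) + β • (shiftA n *ᵥ (ζ - η))
      - (β * (vecC n ⬝ᵥ (ζ - η))) • (matQ₁ n *ᵥ vecC n) + v with hε'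
  have d1 : ∀ i, HasDerivWithinAt (fun s => rescale ((T - s)⁻¹ ^ 1) (ξ s).ofLp i)
      (((T - t)⁻¹ • η') i) (Set.Ico 0 τ) t := by
    intro i
    have hx := h.deriv_ξ t ht i
    rw [h.eq_u t ht] at hx
    refine (hasDerivWithinAt_rescale (x := fun s => (ξ s).ofLp) htT 1 hx).congr_deriv ?_
    have e := rescale_observerField hT β htT (x₀ t) (x t) (ξ t) i
    rw [pow_one, e, hη']
    have e2 := matE_mulVec η i
    rw [hη, pow_one] at e2
    simp only [Pi.add_apply, Pi.sub_apply, Pi.smul_apply, smul_eq_mul, hη, hζ, pow_one, e2]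
    push_cast
    ring
  -- The weight of ζ differentiates to 2E/s. One copy is Eζ = Eη + E(ζ - η), shared between η' and
  -- ε'; the other sits in v. The control term and the injection then match those of η', so that
  -- subtracting `d1` leaves the error dynamics.
  have d2 : ∀ i, HasDerivWithinAt (fun s => rescale ((T - s)⁻¹ ^ 2) (x s).ofLp i)
      (((T - t)⁻¹ • (η' + ε') + (-3 * κ) • (shiftA n *ᵥ (η + (ζ - η)))) i) (Set.Ico 0 τ) t := by
    intro i
    have hx := h.deriv_x t ht i
    rw [h.u₀_eq hT hτ ht] at hx
    refine (hasDerivWithinAt_rescale (x := fun s => (x s).ofLp) htT 2 hx).congr_deriv ?_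
    have e := rescale_plantField hT β κ htT φ (x t) (ξ t) i
    rw [← h.eq_u t ht, ← hζ, ← hv] at e
    have e1 : rescale (T - t)⁻¹ (ξ t).ofLp = η := by rw [hη, pow_one]
    rw [e1] at e
    have e2 := matE_mulVec η i
    have e3 := matE_mulVec ζ i
    have e4 := matE_mulVec (ζ - η) i
    rw [hη', hε', add_sub_cancel]
    simp only [Matrix.mulVec_sub, Pi.add_apply, Pi.sub_apply, Pi.smul_apply, smul_eq_mul] at e e3 ⊢
    rw [← hζ]
    push_cast
    linear_combination e - (T - t)⁻¹ * e3
  have d3 : ∀ i, HasDerivWithinAt (fun s => (rescale ((T - s)⁻¹ ^ 2) (x s).ofLp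
      - rescale ((T - s)⁻¹ ^ 1) (ξ s).ofLp) i)
      (((T - t)⁻¹ • ε' + (-3 * κ) • (shiftA n *ᵥ (η + (ζ - η)))) i) (Set.Ico 0 τ) t := by
    intro i
    refine ((d2 i).sub (d1 i)).congr_deriv ?_
    simp only [Pi.add_apply, Pi.smul_apply, smul_eq_mul]
    ring
  have D1 := hasDerivWithinAt_dotProduct_mulVec (matP₁_posDef n).isHermitian d1
  have D2 := hasDerivWithinAt_dotProduct_mulVec (matR_posDef n).isHermitian d3
  refine ⟨_, D1.add (D2.const_mul (2 * gainQ n)), ?_⟩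
  have hvb : v ⬝ᵥ v ≤ coefD T c ^ 2 * ((η + (ζ - η)) ⬝ᵥ (η + (ζ - η))) := by
    rw [add_sub_cancel]
    exact scaledNonlinearity_dotProduct_self_le hs (by linarith [ht.1])
      (fun i j hij => hφ.coef_nonneg hT hij)
      (fun i => hφ.2 i t ⟨ht.1, htT⟩ (u t) (x t))
  have K1 := lyap_dissipation T c hvb
  have K2 := lyap_coupling_le η (ζ - η)
  have hL : lyapAlong T x ξ t = lyap η (ζ - η) := rfl
  rw [hL]
  rw [← hζ, ← hη]
  rw [← hη', ← hε'] at K1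
  simp only [Matrix.mulVec_add _ ((T - t)⁻¹ • ε'), Matrix.mulVec_smul, dotProduct_add,
    dotProduct_smul, smul_eq_mul]
  set L := lyap η (ζ - η)
  set Y := η ⬝ᵥ (matP₁ n *ᵥ η')
  set X := (ζ - η) ⬝ᵥ (matR n *ᵥ ε')
  set Z := (ζ - η) ⬝ᵥ (matR n *ᵥ (shiftA n *ᵥ (η + (ζ - η))))
  have hq := gainQ_pos n
  have k1 := mul_le_mul_of_nonneg_left K1 (inv_pos.mpr hs).le
  have k2 := mul_le_mul_of_nonneg_left K2 (by positivity : 0 ≤ 3 * |κ|)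
  have k3 : -3 * κ * Z ≤ 3 * |κ| * |Z| := by
    have := neg_le_abs (κ * Z)
    rw [abs_mul] at this
    linarith
  have k4 := mul_le_mul_of_nonneg_left k3 (by linarith : 0 ≤ 4 * gainQ n)
  linarith

/-- Multiplication by the integrating factor (T-t)⁻³ e^(-kt) makes the Lyapunov function antitone.
-/
theorem IsClosedLoop.lyapAlong_le (hT : 0 < T) (hτ : τ ≤ T) (hφ : Admissible T c φ)
    (h : IsClosedLoop T (beta T c) φ τ x₀ x ξ u₀ u) {t : ℝ} (ht : t ∈ Set.Ico 0 τ) :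
    lyapAlong T x ξ t ≤ lyapAlong T x ξ 0 * ((T - t) / T) ^ 3 *
      Real.exp (3 * |x₀ 0 / T ^ 3 + beta T c / (2 * T)| * growthK n * t) := by
  set k := 3 * |x₀ 0 / T ^ 3 + beta T c / (2 * T)| * growthK n
  choose! L' hL' hle using fun t ht => h.lyapAlong_deriv (t := t) hT hτ hφ ht
  have hd : ∀ s ∈ Set.Ico 0 τ, HasDerivWithinAt
      (fun s => lyapAlong T x ξ s * ((T - s)⁻¹ ^ 3 * Real.exp (-k * s)))
      (((T - s)⁻¹ ^ 3 * Real.exp (-k * s)) *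
        (L' s + (3 * (T - s)⁻¹ - k) * lyapAlong T x ξ s)) (Set.Ico 0 τ) s := by
    intro s hs
    have hsT : s < T := hs.2.trans_le hτ
    have h2 := (((hasDerivAt_id s).const_mul (-k)).exp).hasDerivWithinAt (s := Set.Ico 0 τ)
    have h3 := (hL' s hs).mul (((hasDerivWithinAt_inv_sub hsT (Set.Ico 0 τ)).pow 3).mul h2)
    refine h3.congr_deriv ?_
    simp only [Pi.mul_apply, Pi.pow_apply, id]
    generalize (T - s)⁻¹ = g
    push_cast
    ring
  have hanti : AntitoneOn (fun s => lyapAlong T x ξ s * ((T - s)⁻¹ ^ 3 * Real.exp (-k * s)))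
      (Set.Ico 0 τ) := by
    refine antitoneOn_of_hasDerivWithinAt_nonpos (convex_Ico 0 τ)
      (fun s hs => (hd s hs).continuousWithinAt)
      (fun s hs => (hd s (interior_subset hs)).mono interior_subset) fun s hs => ?_
    have hs' := interior_subset hs
    have hsT : 0 < T - s := sub_pos.mpr (hs'.2.trans_le hτ)
    refine mul_nonpos_of_nonneg_of_nonpos (by positivity) ?_
    have := hle s hs'
    linarith
  have h0 : (0 : ℝ) ∈ Set.Ico 0 τ := ⟨le_rfl, ht.1.trans_lt ht.2⟩
  have hfin := hanti h0 ht ht.1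
  have hs : 0 < T - t := sub_pos.mpr (ht.2.trans_le hτ)
  beta_reduce at hfin
  rw [mul_zero, Real.exp_zero, sub_zero, mul_one] at hfin
  have hp : 0 < (T - t) ^ 3 * Real.exp (k * t) := by positivity
  have := mul_le_mul_of_nonneg_right hfin hp.le
  have e : lyapAlong T x ξ t * ((T - t)⁻¹ ^ 3 * Real.exp (-k * t)) * ((T - t) ^ 3 * Real.exp (k * t))
      = lyapAlong T x ξ t := by
    have e1 : Real.exp (-k * t) * Real.exp (k * t) = 1 := by
      rw [← Real.exp_add]; simp
    have e2 : (T - t)⁻¹ ^ 3 * (T - t) ^ 3 = 1 := by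
      rw [← mul_pow, inv_mul_cancel₀ hs.ne', one_pow]
    linear_combination (lyapAlong T x ξ t * ((T - t)⁻¹ ^ 3 * (T - t) ^ 3)) * e1
      + lyapAlong T x ξ t * e2
  rw [e] at this
  refine this.trans (le_of_eq ?_)
  rw [div_pow, inv_pow]
  ring

end Lyapunov

/-! ### From the Lyapunov function to the norms -/

theorem norm_sq_eq_dotProduct {n : ℕ} (x : EuclideanSpace ℝ (Fin n)) :
    ‖x‖ ^ 2 = x.ofLp ⬝ᵥ x.ofLp := by
  rw [EuclideanSpace.real_norm_sq_eq, dotProduct]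
  exact Finset.sum_congr rfl fun i _ => sq _

theorem rescale_dotProduct_self_le {n : ℕ} {g C : ℝ} (hg : 0 ≤ g) (hgC : g ≤ C) (hC : 1 ≤ C)
    (x : Fin n → ℝ) : rescale g x ⬝ᵥ rescale g x ≤ (C ^ n) ^ 2 * (x ⬝ᵥ x) := by
  simp only [dotProduct, Finset.mul_sum]
  refine Finset.sum_le_sum fun i _ => ?_
  have h1 : g ^ (i.rev : ℕ) ≤ C ^ n :=
    (pow_le_pow_left₀ hg hgC _).trans (pow_le_pow_right₀ hC i.rev.2.le)
  have h2 := pow_le_pow_left₀ (pow_nonneg hg _) h1 2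
  have h3 := mul_le_mul_of_nonneg_right h2 (mul_self_nonneg (x i))
  rw [rescale]
  linarith

theorem rescale_rescale_inv {n : ℕ} {g : ℝ} (hg : g ≠ 0) (x : Fin n → ℝ) :
    rescale g (rescale g⁻¹ x) = x := by
  funext i
  rw [rescale, rescale, ← mul_assoc, ← mul_pow, mul_inv_cancel₀ hg, one_pow, one_mul]

theorem add_dotProduct_add_self_le {n : ℕ} (x y : Fin n → ℝ) :
    (x + y) ⬝ᵥ (x + y) ≤ 2 * (x ⬝ᵥ x + y ⬝ᵥ y) := by
  have := dotProduct_self_nonneg' (x - y)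
  rw [sub_dotProduct, dotProduct_sub, dotProduct_sub, dotProduct_comm y x] at this
  rw [add_dotProduct, dotProduct_add, dotProduct_add, dotProduct_comm y x]
  linarith

/-- Undoing the weights multiplies by nonnegative powers of s ≤ T, so the constant is uniform in s.
The last bound concerns bᵀPη itself, since passing through ξ would lose the exact power of s needed
for u. -/
theorem exists_state_le_lyap (n : ℕ) [NeZero n] (T : ℝ) :
    ∃ M : ℝ, 0 < M ∧ ∀ s ∈ Set.Ioc 0 T, ∀ x ξ : Fin n → ℝ,
      x ⬝ᵥ x ≤ M * lyap (rescale (s⁻¹ ^ 1) ξ) (rescale (s⁻¹ ^ 2) x - rescale (s⁻¹ ^ 1) ξ) ∧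
      ξ ⬝ᵥ ξ ≤ M * lyap (rescale (s⁻¹ ^ 1) ξ) (rescale (s⁻¹ ^ 2) x - rescale (s⁻¹ ^ 1) ξ) ∧
      (vecB n ⬝ᵥ (matP₁ n *ᵥ rescale (s⁻¹ ^ 1) ξ)) ^ 2 ≤
        M * lyap (rescale (s⁻¹ ^ 1) ξ) (rescale (s⁻¹ ^ 2) x - rescale (s⁻¹ ^ 1) ξ) := by
  have hΛ := bigLambda_nonneg n
  have hq := gainQ_pos n
  set M' := 2 * bigLambda n * (1 + 1 / (2 * gainQ n))
  have hM' : 0 ≤ M' := by positivity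
  -- Dominates both s and s², and C ≥ 1 lets Cⁿ dominate every weight.
  set C := (max 1 T) ^ 2
  have hmax : 1 ≤ max 1 T := le_max_left _ _
  have hC : 1 ≤ C := one_le_pow₀ hmax
  set p := (matP₁ n *ᵥ vecB n) ⬝ᵥ (matP₁ n *ᵥ vecB n)
  have hp : 0 ≤ p := dotProduct_self_nonneg' _
  refine ⟨(C ^ n) ^ 2 * M' + p * M' + 1, by positivity, fun s hs x ξ => ?_⟩
  have hs0 : 0 < s := hs.1
  set η := rescale (s⁻¹ ^ 1) ξ with hη
  set ζ := rescale (s⁻¹ ^ 2) x with hζ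
  set L := lyap η (ζ - η) with hL
  have hL0 : 0 ≤ L := lyap_nonneg _ _
  have h1 : η ⬝ᵥ η ≤ bigLambda n * L := by
    refine (dotProduct_self_le_matP₁ η).trans (mul_le_mul_of_nonneg_left ?_ hΛ)
    rw [hL, lyap]
    exact le_add_of_nonneg_right (mul_nonneg (by linarith) (dotProduct_matR_self_nonneg _))
  have h2 : (ζ - η) ⬝ᵥ (ζ - η) ≤ bigLambda n * (1 / (2 * gainQ n) * L) := by
    refine (dotProduct_self_le_matR (ζ - η)).trans (mul_le_mul_of_nonneg_left ?_ hΛ)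
    rw [one_div, le_inv_mul_iff₀ (by linarith), hL, lyap]
    exact le_add_of_nonneg_left (dotProduct_matP₁_self_nonneg _)
  have h3 := add_dotProduct_add_self_le η (ζ - η)
  rw [add_sub_cancel] at h3
  have hζL : ζ ⬝ᵥ ζ ≤ M' * L := by
    have : M' * L = 2 * (bigLambda n * L + bigLambda n * (1 / (2 * gainQ n) * L)) := by
      simp only [M']; ring
    rw [this]
    linarith
  have hηL : η ⬝ᵥ η ≤ M' * L := by
    have : M' * L = 2 * (bigLambda n * L + bigLambda n * (1 / (2 * gainQ n) * L)) := by
      simp only [M']; ring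
    have h4 : 0 ≤ bigLambda n * (1 / (2 * gainQ n) * L) := by positivity
    have h5 : 0 ≤ bigLambda n * L := by positivity
    rw [this]
    linarith
  have key : ∀ m : ℕ, m ≤ 2 → ∀ y : Fin n → ℝ, rescale (s⁻¹ ^ m) y ⬝ᵥ rescale (s⁻¹ ^ m) y ≤ M' * L →
      y ⬝ᵥ y ≤ ((C ^ n) ^ 2 * M' + p * M' + 1) * L := by
    intro m hm y hy
    have hsm : s ^ m ≠ 0 := (pow_pos hs0 m).ne'
    have hsC : s ^ m ≤ C := (pow_le_pow_left₀ hs0.le (hs.2.trans (le_max_right 1 T)) m).trans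
      (pow_le_pow_right₀ hmax hm)
    have h := rescale_dotProduct_self_le (pow_nonneg hs0.le m) hsC hC (rescale (s ^ m)⁻¹ y)
    rw [rescale_rescale_inv hsm, ← inv_pow] at h
    have h' := mul_le_mul_of_nonneg_left hy (by positivity : 0 ≤ (C ^ n) ^ 2)
    have h'' : 0 ≤ p * M' * L := by positivity
    linarith
  refine ⟨key 2 le_rfl x hζL, key 1 one_le_two ξ hηL, ?_⟩
  rw [dotProduct_mulVec_comm_of_isHermitian (matP₁_posDef n).isHermitian, dotProduct_comm]
  have h6 := dotProduct_sq_le (matP₁ n *ᵥ vecB n) η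
  have h7 := mul_le_mul_of_nonneg_left hηL hp
  have h8 : 0 ≤ (C ^ n) ^ 2 * M' * L := by positivity
  linarith

theorem exists_lyap_initial_le (n : ℕ) [NeZero n] {T : ℝ} (hT : 0 < T) :
    ∃ M : ℝ, 0 < M ∧ ∀ x ξ : EuclideanSpace ℝ (Fin n),
      lyap (rescale (T⁻¹ ^ 1) ξ.ofLp) (rescale (T⁻¹ ^ 2) x.ofLp - rescale (T⁻¹ ^ 1) ξ.ofLp) ≤
        M * (‖x‖ + ‖ξ‖) ^ 2 := by
  have hΛ := bigLambda_nonneg n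
  have hq := gainQ_pos n
  set C := (max 1 T⁻¹) ^ 2
  have hmax : 1 ≤ max 1 T⁻¹ := le_max_left _ _
  have hC : 1 ≤ C := one_le_pow₀ hmax
  set D := bigLambda n + 4 * gainQ n * bigLambda n
  have hD : 0 ≤ D := by positivity
  refine ⟨D * (C ^ n) ^ 2 + 1, by positivity, fun x ξ => ?_⟩
  have hTC : ∀ m ≤ 2, T⁻¹ ^ m ≤ C := fun m hm =>
    (pow_le_pow_left₀ (by positivity) (le_max_right 1 T⁻¹) m).trans (pow_le_pow_right₀ hmax hm)
  have h1 := rescale_dotProduct_self_le (by positivity) (hTC 1 one_le_two) hC ξ.ofLp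
  have h2 := rescale_dotProduct_self_le (by positivity) (hTC 2 le_rfl) hC x.ofLp
  set η := rescale (T⁻¹ ^ 1) ξ.ofLp
  set ζ := rescale (T⁻¹ ^ 2) x.ofLp
  rw [← norm_sq_eq_dotProduct ξ] at h1
  rw [← norm_sq_eq_dotProduct x] at h2
  have h3 := add_dotProduct_add_self_le ζ (-η)
  rw [← sub_eq_add_neg, neg_dotProduct, dotProduct_neg, neg_neg] at h3
  have h4 := dotProduct_matP₁_le η
  have h5 := dotProduct_matR_le (ζ - η)
  have h6 : bigLambda n * ((ζ - η) ⬝ᵥ (ζ - η)) ≤ bigLambda n * (2 * (ζ ⬝ᵥ ζ + η ⬝ᵥ η)) :=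
    mul_le_mul_of_nonneg_left h3 hΛ
  have h7 := mul_le_mul_of_nonneg_left (h5.trans h6) (by linarith : 0 ≤ 2 * gainQ n)
  have h8 : lyap η (ζ - η) ≤ D * (ζ ⬝ᵥ ζ + η ⬝ᵥ η) := by
    have h9 := mul_nonneg hΛ (dotProduct_self_nonneg' ζ)
    rw [lyap]
    simp only [D]
    linarith
  have hx := norm_nonneg x
  have hξ := norm_nonneg ξ
  have h9 : ζ ⬝ᵥ ζ + η ⬝ᵥ η ≤ (C ^ n) ^ 2 * (‖x‖ + ‖ξ‖) ^ 2 := by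
    have : 0 ≤ (C ^ n) ^ 2 * (‖x‖ * ‖ξ‖) := by positivity
    linarith
  have h10 := mul_le_mul_of_nonneg_left h9 hD
  have h11 := sq_nonneg (‖x‖ + ‖ξ‖)
  linarith

theorem le_of_sq_le_rpow {y M s w N : ℝ} (hM : 0 ≤ M) (hs : 0 ≤ s) (hN : 0 ≤ N) (p : ℕ)
    (h : y ^ 2 ≤ M * s ^ p * Real.exp (2 * w) * N ^ 2) :
    |y| ≤ √M * Real.exp w * s ^ ((p : ℝ) / 2) * N := by
  refine abs_le_of_sq_le_sq (h.trans (le_of_eq ?_)) (by positivity)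
  rw [mul_pow, mul_pow, mul_pow, Real.sq_sqrt hM, ← Real.rpow_natCast (s ^ ((p : ℝ) / 2)),
    ← Real.rpow_mul hs]
  push_cast
  rw [div_mul_cancel₀ _ (two_ne_zero), Real.rpow_natCast, two_mul w, Real.exp_add]
  ring

/-- The constants in the bounds depend on `n`, `T` and `c` only. -/
theorem exists_closedLoop_bounds {n : ℕ} [NeZero n] {T : ℝ} (hT : 0 < T)
    (c : Fin n → Fin n → ℝ) :
    ∃ M ρ : ℝ, 0 < M ∧ 0 < ρ ∧ ∀ φ : Fin n → ℝ → ℝ → EuclideanSpace ℝ (Fin n) → ℝ,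
      Admissible T c φ → ∀ τ ≤ T, ∀ (x₀ : ℝ → ℝ) (x ξ : ℝ → EuclideanSpace ℝ (Fin n))
        (u₀ u : ℝ → ℝ), IsClosedLoop T (beta T c) φ τ x₀ x ξ u₀ u → ∀ t ∈ Set.Ico 0 τ,
          ‖x t‖ ^ 2 ≤ M * (T - t) ^ 3 * Real.exp (2 * (ρ * |x₀ 0| * t)) * (‖x 0‖ + ‖ξ 0‖) ^ 2 ∧
          ‖ξ t‖ ^ 2 ≤ M * (T - t) ^ 3 * Real.exp (2 * (ρ * |x₀ 0| * t)) * (‖x 0‖ + ‖ξ 0‖) ^ 2 ∧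
          u t ^ 2 ≤ M * (T - t) ^ 1 * Real.exp (2 * (ρ * |x₀ 0| * t)) *
            (‖x 0‖ + ‖ξ 0‖) ^ 2 := by
  obtain ⟨M₁, hM₁, h₁⟩ := exists_state_le_lyap n T
  obtain ⟨M₀, hM₀, h₀⟩ := exists_lyap_initial_le n hT
  have hβ := beta_pos T c
  have hK := growthK_nonneg n
  set β := beta T c
  set K := growthK n
  set E := M₀ / T ^ 3 * Real.exp (3 * K * β / 2)
  -- The part β/(2T) of κ contributes at most 3Kβ/2 to the exponent because t < T; `E` absorbs it,
  -- so only |x₀(0)| remains in the rate.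
  have hE : 0 < E := by positivity
  -- The rate carries a 1/2 because the bounds are for squares, and + 1 makes it positive. The
  -- factor 1 + β² serves the states and the control at once.
  refine ⟨M₁ * E * (1 + β ^ 2), 3 * K / (2 * T ^ 3) + 1, by positivity, by positivity, ?_⟩
  intro φ hφ τ hτ x₀ x ξ u₀ u h t ht
  have htT : t < T := ht.2.trans_le hτ
  have hs : 0 < T - t := sub_pos.mpr htT
  have ht0 := ht.1
  obtain ⟨hx, hξ, hu⟩ := h₁ (T - t) ⟨hs, by linarith⟩ (x t).ofLp (ξ t).ofLp
  have hL := h.lyapAlong_le hT hτ hφ ht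
  have hL0 : lyapAlong T x ξ 0 ≤ M₀ * (‖x 0‖ + ‖ξ 0‖) ^ 2 := by
    have := h₀ (x 0) (ξ 0)
    rwa [lyapAlong, sub_zero]
  set N := ‖x 0‖ + ‖ξ 0‖
  set ρ := 3 * K / (2 * T ^ 3) + 1
  have hexp : Real.exp (3 * |x₀ 0 / T ^ 3 + β / (2 * T)| * K * t) ≤
      Real.exp (3 * K * β / 2) * Real.exp (2 * (ρ * |x₀ 0| * t)) := by
    rw [← Real.exp_add, Real.exp_le_exp]
    have e1 : |x₀ 0 / T ^ 3 + β / (2 * T)| ≤ |x₀ 0| / T ^ 3 + β / (2 * T) := by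
      refine (abs_add_le _ _).trans (le_of_eq ?_)
      rw [abs_div, abs_of_pos (by positivity : 0 < T ^ 3),
        abs_of_pos (by positivity : 0 < β / (2 * T))]
    have e2 := mul_le_mul_of_nonneg_left e1 (by positivity : 0 ≤ 3 * K * t)
    have e3 : β / (2 * T) * t ≤ β / 2 := by
      rw [div_mul_eq_mul_div, div_le_div_iff₀ (by positivity) two_pos]
      have := mul_le_mul_of_nonneg_left htT.le hβ.le
      linarith
    have e4 := mul_le_mul_of_nonneg_left e3 (by positivity : 0 ≤ 3 * K)
    have e5 : 0 ≤ |x₀ 0| * t := by positivity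
    have e6 : 2 * (ρ * |x₀ 0| * t) = 3 * K * t * (|x₀ 0| / T ^ 3) + 2 * (|x₀ 0| * t) := by
      simp only [ρ]
      field_simp
    linarith
  have hLE : lyapAlong T x ξ t ≤ E * (T - t) ^ 3 * Real.exp (2 * (ρ * |x₀ 0| * t)) * N ^ 2 := by
    refine hL.trans ?_
    have e1 : lyapAlong T x ξ 0 * ((T - t) / T) ^ 3 ≤ M₀ * N ^ 2 * ((T - t) / T) ^ 3 :=
      mul_le_mul_of_nonneg_right hL0 (by positivity)
    refine (mul_le_mul e1 hexp (by positivity) (by positivity)).trans (le_of_eq ?_)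
    simp only [E, div_pow]
    ring
  have hLM := mul_le_mul_of_nonneg_left hLE hM₁.le
  set G := E * (T - t) ^ 3 * Real.exp (2 * (ρ * |x₀ 0| * t)) * N ^ 2 with hG
  have hG0 : 0 ≤ M₁ * G := by positivity
  have hGe : M₁ * E * (1 + β ^ 2) * (T - t) ^ 3 * Real.exp (2 * (ρ * |x₀ 0| * t)) * N ^ 2
      = M₁ * G + β ^ 2 * (M₁ * G) := by rw [hG]; ring
  have hG1 : 0 ≤ β ^ 2 * (M₁ * G) := by positivity
  refine ⟨?_, ?_, ?_⟩
  · rw [norm_sq_eq_dotProduct, hGe]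
    exact hx.trans (hLM.trans (by linarith))
  · rw [norm_sq_eq_dotProduct, hGe]
    exact hξ.trans (hLM.trans (by linarith))
  · have hu' := hu.trans hLM
    rw [h.eq_u t ht, control_eq hT β htT, neg_sq, mul_pow, mul_pow]
    rw [pow_one] at hu'
    have h2 := mul_le_mul_of_nonneg_left hu' (by positivity : 0 ≤ β ^ 2 * (T - t)⁻¹ ^ 2)
    refine h2.trans ?_
    -- The factor β/(T-t) in u costs two powers of T - t in the square.
    have e1 : (T - t)⁻¹ ^ 2 * (T - t) ^ 3 = (T - t) ^ 1 := by
      field_simp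
    have e2 : β ^ 2 * (T - t)⁻¹ ^ 2 * (M₁ * G) =
        β ^ 2 * (M₁ * (E * (T - t) ^ 1 * Real.exp (2 * (ρ * |x₀ 0| * t)) * N ^ 2)) := by
      rw [← e1, hG]; ring
    rw [e2]
    have e3 : 0 ≤ M₁ * (E * (T - t) ^ 1 * Real.exp (2 * (ρ * |x₀ 0| * t)) * N ^ 2) := by positivity
    linarith

theorem abs_x₀_le {T β t a : ℝ} (hT : 0 < T) (hβ : 0 < β) (ht : 0 ≤ t) (htT : t < T) :
    |(T - t) ^ 3 * (a / T ^ 3 + β / (2 * T)) - β / 2 * (T - t) ^ 2| ≤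
      (T - t) ^ 2 * ((T - t) / T ^ 3 * |a| + β * t / (2 * T)) := by
  have hs : 0 < T - t := sub_pos.mpr htT
  have e : (T - t) ^ 3 * (a / T ^ 3 + β / (2 * T)) - β / 2 * (T - t) ^ 2 =
      (T - t) ^ 2 * ((T - t) / T ^ 3 * a - β * t / (2 * T)) := by
    field_simp
    ring
  rw [e, abs_mul, abs_of_pos (by positivity : 0 < (T - t) ^ 2)]
  refine mul_le_mul_of_nonneg_left ((abs_sub _ _).trans (le_of_eq ?_)) (by positivity)
  rw [abs_mul, abs_of_pos (by positivity : 0 < (T - t) / T ^ 3),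
    abs_of_nonneg (by positivity : 0 ≤ β * t / (2 * T))]

theorem abs_u₀_le {T β t a : ℝ} (hT : 0 < T) (hβ : 0 < β) (htT : t < T) :
    |(T - t) * (β - 3 * (T - t) * (a / T ^ 3 + β / (2 * T)))| ≤
      (T - t) * (3 * (T - t) * (|a| / T ^ 3 + β / (2 * T)) + β) := by
  have hs : 0 < T - t := sub_pos.mpr htT
  rw [abs_mul, abs_of_pos hs]
  refine mul_le_mul_of_nonneg_left ((abs_sub _ _).trans ?_) hs.le
  rw [abs_mul, abs_of_pos (by positivity : 0 < 3 * (T - t)), abs_of_pos hβ, add_comm]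
  refine add_le_add_left (mul_le_mul_of_nonneg_left ?_ (by positivity)) _
  refine (abs_add_le _ _).trans (le_of_eq ?_)
  rw [abs_div, abs_of_pos (by positivity : 0 < T ^ 3), abs_of_pos (by positivity : 0 < β / (2 * T))]

/-! ### Peano existence by Euler polygons -/

section Peano

variable {E : Type*} [NormedAddCommGroup E] [NormedSpace ℝ E]

/-- The nodes of the Euler polygon with step `h`. -/
def eulerNode (f : ℝ → E → E) (a : E) (h : ℝ) : ℕ → E
  | 0 => a
  | j + 1 => eulerNode f a h j + h • f (j * h) (eulerNode f a h j)

/-- The piecewise constant velocity of the Euler polygon with step `h`. -/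
noncomputable def eulerVelocity (f : ℝ → E → E) (a : E) (h s : ℝ) : E :=
  f (⌊s / h⌋₊ * h) (eulerNode f a h ⌊s / h⌋₊)

/-- The Euler polygon with step `h`. -/
noncomputable def eulerPolygon (f : ℝ → E → E) (a : E) (h t : ℝ) : E :=
  a + ∫ s in (0 : ℝ)..t, eulerVelocity f a h s

/-- Discrete Grönwall: each step multiplies the norm by at most 1 + Kh ≤ e^(Kh). -/
theorem norm_eulerNode_le {f : ℝ → E → E} {a : E} {h b K : ℝ} (hh : 0 < h)
    (hf : ∀ t ∈ Set.Icc 0 b, ∀ y, ‖f t y‖ ≤ K * ‖y‖) :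
    ∀ j : ℕ, j * h ≤ b → ‖eulerNode f a h j‖ ≤ Real.exp (K * (j * h)) * ‖a‖ := by
  intro j
  induction j with
  | zero => intro _; simp [eulerNode]
  | succ j ih =>
    intro hj
    push_cast at hj
    have hjb : j * h ≤ b := by linarith
    have h1 := ih hjb
    have h2 := hf (j * h) ⟨by positivity, hjb⟩ (eulerNode f a h j)
    calc ‖eulerNode f a h (j + 1)‖
        ≤ ‖eulerNode f a h j‖ + h * (K * ‖eulerNode f a h j‖) := by
          refine (norm_add_le _ _).trans ?_
          rw [norm_smul, Real.norm_of_nonneg hh.le]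
          gcongr
      _ = (K * h + 1) * ‖eulerNode f a h j‖ := by ring
      _ ≤ Real.exp (K * h) * (Real.exp (K * (j * h)) * ‖a‖) :=
          mul_le_mul (Real.add_one_le_exp _) h1 (norm_nonneg _) (Real.exp_pos _).le
      _ = Real.exp (K * (((j + 1 : ℕ) : ℝ) * h)) * ‖a‖ := by
          rw [← mul_assoc, ← Real.exp_add]
          push_cast
          ring_nf

theorem floor_div_mul_le {h s : ℝ} (hh : 0 < h) (hs : 0 ≤ s) : ⌊s / h⌋₊ * h ≤ s := by
  have := Nat.floor_le (div_nonneg hs hh.le)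
  rwa [le_div_iff₀ hh] at this

theorem lt_floor_div_mul_add {h : ℝ} (hh : 0 < h) (s : ℝ) : s < ⌊s / h⌋₊ * h + h := by
  have := Nat.lt_floor_add_one (s / h)
  rw [div_lt_iff₀ hh] at this
  linarith

theorem norm_eulerVelocity_le {f : ℝ → E → E} {a : E} {h b K : ℝ} (hh : 0 < h) (hK : 0 ≤ K)
    (hf : ∀ t ∈ Set.Icc 0 b, ∀ y, ‖f t y‖ ≤ K * ‖y‖) {s : ℝ} (hs : s ∈ Set.Icc 0 b) :
    ‖eulerVelocity f a h s‖ ≤ K * (Real.exp (K * b) * ‖a‖) := by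
  have h1 := floor_div_mul_le hh hs.1
  have h2 : ⌊s / h⌋₊ * h ≤ b := h1.trans hs.2
  refine (hf _ ⟨by positivity, h2⟩ _).trans (mul_le_mul_of_nonneg_left ?_ hK)
  refine (norm_eulerNode_le hh hf _ h2).trans ?_
  gcongr

theorem intervalIntegrable_eulerVelocity [FiniteDimensional ℝ E] {f : ℝ → E → E} {a : E}
    {h T : ℝ} (hh : 0 < h)
    (hf : ∀ b < T, ∃ K, 0 ≤ K ∧ ∀ t ∈ Set.Icc 0 b, ∀ y, ‖f t y‖ ≤ K * ‖y‖) {s t : ℝ}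
    (hs : s ∈ Set.Ico 0 T) (ht : t ∈ Set.Ico 0 T) :
    IntervalIntegrable (eulerVelocity f a h) MeasureTheory.volume s t := by
  borelize E
  have hm : Measurable (eulerVelocity f a h) :=
    (measurable_from_top (f := fun j : ℕ => f (j * h) (eulerNode f a h j))).comp
      (Nat.measurable_floor.comp (measurable_id.div_const h))
  obtain ⟨K, hK, hb⟩ := hf (max s t) (max_lt hs.2 ht.2)
  rw [intervalIntegrable_iff]
  refine MeasureTheory.Measure.integrableOn_of_bounded (M := K * (Real.exp (K * max s t) * ‖a‖))
    (by simp [Set.uIoc]) hm.aestronglyMeasurable ?_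
  refine (MeasureTheory.ae_restrict_mem measurableSet_uIoc).mono fun r hr => ?_
  exact norm_eulerVelocity_le hh hK hb
    ⟨(le_min hs.1 ht.1).trans hr.1.le, hr.2⟩

theorem eulerPolygon_sub [FiniteDimensional ℝ E] {f : ℝ → E → E} {a : E} {h T : ℝ} (hh : 0 < h)
    (hf : ∀ b < T, ∃ K, 0 ≤ K ∧ ∀ t ∈ Set.Icc 0 b, ∀ y, ‖f t y‖ ≤ K * ‖y‖) {s t : ℝ}
    (hs : s ∈ Set.Ico 0 T) (ht : t ∈ Set.Ico 0 T) :
    eulerPolygon f a h t - eulerPolygon f a h s = ∫ r in s..t, eulerVelocity f a h r := by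
  have h0 : (0 : ℝ) ∈ Set.Ico 0 T := ⟨le_rfl, hs.1.trans_lt hs.2⟩
  rw [eulerPolygon, eulerPolygon, add_sub_add_left_eq_sub]
  exact intervalIntegral.integral_interval_sub_left
    (intervalIntegrable_eulerVelocity hh hf h0 ht) (intervalIntegrable_eulerVelocity hh hf h0 hs)

/-- Used with w = 0 for equi-Lipschitz bounds and with w = f(t, x(t)) for differentiability of the
limit. -/
theorem norm_eulerPolygon_sub_sub_le [FiniteDimensional ℝ E] {f : ℝ → E → E} {a : E} {h T : ℝ}
    (hh : 0 < h)
    (hf : ∀ b < T, ∃ K, 0 ≤ K ∧ ∀ t ∈ Set.Icc 0 b, ∀ y, ‖f t y‖ ≤ K * ‖y‖) {s t : ℝ}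
    (hs : s ∈ Set.Ico 0 T) (ht : t ∈ Set.Ico 0 T) {w : E} {ε : ℝ}
    (hw : ∀ r ∈ Set.uIcc s t, ‖eulerVelocity f a h r - w‖ ≤ ε) :
    ‖eulerPolygon f a h t - eulerPolygon f a h s - (t - s) • w‖ ≤ ε * |t - s| := by
  rw [eulerPolygon_sub hh hf hs ht, ← intervalIntegral.integral_const,
    ← intervalIntegral.integral_sub (intervalIntegrable_eulerVelocity hh hf hs ht)
      intervalIntegrable_const]
  exact intervalIntegral.norm_integral_le_of_norm_le_const fun r hr =>
    hw r (Set.uIoc_subset_uIcc hr)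

theorem eulerPolygon_node [FiniteDimensional ℝ E] {f : ℝ → E → E} {a : E} {h T : ℝ} (hh : 0 < h)
    (hf : ∀ b < T, ∃ K, 0 ≤ K ∧ ∀ t ∈ Set.Icc 0 b, ∀ y, ‖f t y‖ ≤ K * ‖y‖) :
    ∀ j : ℕ, j * h < T → eulerPolygon f a h (j * h) = eulerNode f a h j := by
  intro j
  induction j with
  | zero => intro _; simp [eulerPolygon, eulerNode]
  | succ j ih =>
    intro hj
    push_cast at hj ⊢
    have hj0 : (0 : ℝ) ≤ j * h := by positivity
    have hjT : j * h < T := by linarith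
    have hsub := eulerPolygon_sub (a := a) hh hf ⟨hj0, hjT⟩
      (show (j + 1 : ℝ) * h ∈ Set.Ico 0 T from ⟨by positivity, hj⟩)
    rw [ih hjT, sub_eq_iff_eq_add'] at hsub
    rw [hsub, eulerNode]
    congr 1
    have hconst : ∫ r in (j * h)..((j + 1) * h), eulerVelocity f a h r
        = ∫ _ in (j * h)..((j + 1) * h), f (j * h) (eulerNode f a h j) := by
      refine intervalIntegral.integral_congr_ae ?_
      -- At the right endpoint the floor jumps to j + 1; this single point is negligible.
      have hne : ∀ᵐ r : ℝ, r ≠ (j + 1) * h := by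
        simp [MeasureTheory.ae_iff]
      filter_upwards [hne] with r hr hmem
      rw [Set.uIoc_of_le (by linarith)] at hmem
      have hfl : ⌊r / h⌋₊ = j := by
        rw [Nat.floor_eq_iff (div_nonneg (hj0.trans hmem.1.le) hh.le), le_div_iff₀ hh,
          div_lt_iff₀ hh]
        exact ⟨hmem.1.le, lt_of_le_of_ne hmem.2 hr⟩
      rw [eulerVelocity, hfl]
    rw [hconst, intervalIntegral.integral_const]
    congr 1
    ring

/-- A Peano existence theorem: a continuous vector field of linear growth on `[0, T)` has a
solution on all of `[0, T)` for each initial value. -/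
theorem exists_solution_of_linear_growth [FiniteDimensional ℝ E] {f : ℝ → E → E} {T : ℝ}
    (hcont : ContinuousOn (fun p : ℝ × E => f p.1 p.2) (Set.Ico 0 T ×ˢ Set.univ))
    (hf : ∀ b < T, ∃ K, 0 ≤ K ∧ ∀ t ∈ Set.Icc 0 b, ∀ y, ‖f t y‖ ≤ K * ‖y‖) (a : E) :
    ∃ x : ℝ → E, x 0 = a ∧ ∀ t ∈ Set.Ico 0 T, HasDerivWithinAt x (f t (x t)) (Set.Ico 0 T) t := by
  let step : ℕ → ℝ := fun k => 1 / ((k : ℝ) + 1)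
  have hstep : ∀ k, 0 < step k := fun k => by positivity
  let X : ℕ → ℝ → E := fun k => eulerPolygon f a (step k)
  -- Pointwise limits along a free ultrafilter replace the extraction of a convergent subsequence:
  -- at each time the polygons stay in a compact ball.
  let U : Ultrafilter ℕ := Filter.hyperfilter ℕ
  have hU : (U : Filter ℕ) ≤ Filter.atTop := Nat.hyperfilter_le_atTop
  have hlip : ∀ b < T, ∃ M, 0 ≤ M ∧ ∀ k, ∀ s ∈ Set.Icc 0 b, ∀ t ∈ Set.Icc 0 b,
      ‖X k t - X k s‖ ≤ M * |t - s| := by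
    intro b hb
    obtain ⟨K, hK, hKb⟩ := hf b hb
    refine ⟨K * (Real.exp (K * b) * ‖a‖), by positivity, fun k s hs t ht => ?_⟩
    have := norm_eulerPolygon_sub_sub_le (a := a) (hstep k) hf (w := 0)
      (ε := K * (Real.exp (K * b) * ‖a‖))
      (⟨hs.1, hs.2.trans_lt hb⟩ : s ∈ Set.Ico 0 T) ⟨ht.1, ht.2.trans_lt hb⟩ (fun r hr => by
        rw [sub_zero]
        exact norm_eulerVelocity_le (hstep k) hK hKb (Set.uIcc_subset_Icc hs ht hr))
    rwa [smul_zero, sub_zero] at this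
  have hX0 : ∀ k, X k 0 = a := fun k => by simp [X, eulerPolygon]
  have hlim : ∀ t, ∃ z : E, t ∈ Set.Ico 0 T → Filter.Tendsto (fun k => X k t) U (𝓝 z) := by
    intro t
    by_cases ht : t ∈ Set.Ico 0 T
    · obtain ⟨M, -, hM⟩ := hlip t ht.2
      have hb : ∀ k, X k t ∈ Metric.closedBall a (M * |t - 0|) := by
        intro k
        have := hM k 0 ⟨le_rfl, ht.1⟩ t ⟨ht.1, le_rfl⟩
        rwa [hX0, ← dist_eq_norm] at this
      obtain ⟨z, -, hz⟩ := (isCompact_closedBall a (M * |t - 0|)).ultrafilter_le_nhds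
        (U.map fun k => X k t) (by
          rw [Filter.le_principal_iff]
          exact Filter.mem_map.mpr (Filter.Eventually.of_forall hb))
      exact ⟨z, fun _ => hz⟩
    · exact ⟨0, fun h => absurd h ht⟩
  choose x hx using hlim
  have hx0 : ∀ t ∈ Set.Ico 0 T, Filter.Tendsto (fun k => X k t) U (𝓝 (x t)) := fun t ht => hx t ht
  by_cases hT : 0 < T
  swap
  · exact ⟨fun _ => a, rfl, fun t ht => absurd (ht.1.trans_lt ht.2) hT⟩
  refine ⟨x, ?_, fun t ht => ?_⟩
  · have := hx0 0 ⟨le_rfl, hT⟩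
    simp only [hX0] at this
    exact (tendsto_nhds_unique this tendsto_const_nhds)
  rw [hasDerivWithinAt_iff_isLittleO, Asymptotics.isLittleO_iff]
  intro ε hε
  have hc := hcont (t, x t) ⟨ht, Set.mem_univ _⟩
  rw [Metric.continuousWithinAt_iff] at hc
  obtain ⟨δ, hδ, hc⟩ := hc ε hε
  set b := (t + T) / 2
  have hbT : b < T := by have := ht.2; simp only [b]; linarith
  have htb : t < b := by have := ht.2; simp only [b]; linarith
  obtain ⟨M, hM0, hM⟩ := hlip b hbT
  -- The first bound keeps the grid point r' below b, where M is valid. The second ensures |r' - t|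
  -- < δ and 2Mδ' ≤ δ/2, so that (r', X_k(r')) is within δ of (t, x(t)).
  set δ' := min (b - t) (δ / (4 * (M + 1)))
  have hδ' : 0 < δ' := lt_min (sub_pos.mpr htb) (by positivity)
  have hδ'1 : δ' ≤ b - t := min_le_left _ _
  have hδ'2 : δ' * (4 * (M + 1)) ≤ δ := by
    rw [← le_div_iff₀ (by positivity)]
    exact min_le_right _ _
  have hball : ∀ᶠ s in 𝓝[Set.Ico 0 T] t, s ∈ Set.Ico 0 T ∧ |s - t| < δ' := by
    refine Filter.Eventually.and self_mem_nhdsWithin (nhdsWithin_le_nhds ?_)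
    exact Metric.ball_mem_nhds t hδ'
  refine hball.mono fun s hs => ?_
  obtain ⟨hsT, hsδ⟩ := hs
  have hev : ∀ᶠ k in (U : Filter ℕ), ‖X k s - X k t - (s - t) • f t (x t)‖ ≤ ε * ‖s - t‖ := by
    have e1 : ∀ᶠ k in (U : Filter ℕ), step k < δ' :=
      hU ((tendsto_one_div_add_atTop_nhds_zero_nat (𝕜 := ℝ)).eventually (gt_mem_nhds hδ'))
    have e2 : ∀ᶠ k in (U : Filter ℕ), dist (X k t) (x t) < δ / 2 :=
      (hx0 t ht).eventually (Metric.ball_mem_nhds _ (by positivity))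
    filter_upwards [e1, e2] with k hk1 hk2
    refine norm_eulerPolygon_sub_sub_le (hstep k) hf ht hsT fun r hr => ?_
    have hrt : |r - t| ≤ |s - t| := Set.abs_sub_left_of_mem_uIcc hr
    have hr0 : 0 ≤ r := (le_min ht.1 hsT.1).trans hr.1
    have h1 := floor_div_mul_le (hstep k) hr0
    have h2 := lt_floor_div_mul_add (hstep k) r
    have h3 : eulerPolygon f a (step k) (⌊r / step k⌋₊ * step k) =
        eulerNode f a (step k) ⌊r / step k⌋₊ :=
      eulerPolygon_node (hstep k) hf _ (h1.trans_lt (hr.2.trans_lt (max_lt ht.2 hsT.2)))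
    rw [eulerVelocity, ← h3]
    have hr'0 : (0 : ℝ) ≤ ⌊r / step k⌋₊ * step k := mul_nonneg (Nat.cast_nonneg _) (hstep k).le
    set r' := (⌊r / step k⌋₊ : ℝ) * step k
    have hr't : |r' - t| < 2 * δ' := by
      rw [abs_lt]
      have := abs_lt.mp (hrt.trans_lt hsδ)
      constructor <;> linarith
    have hrb : r' ≤ b := by
      have := abs_lt.mp (hrt.trans_lt hsδ)
      linarith
    have h4 := hM k t ⟨ht.1, htb.le⟩ r' ⟨hr'0, hrb⟩
    have h5 : M * |r' - t| ≤ M * (2 * δ') := mul_le_mul_of_nonneg_left hr't.le hM0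
    have h6 : dist (X k r') (x t) < δ := by
      have := dist_triangle (X k r') (X k t) (x t)
      rw [dist_eq_norm (X k r') (X k t)] at this
      linarith
    have h7 : dist (r', X k r') (t, x t) < δ := by
      rw [Prod.dist_eq, max_lt_iff, Real.dist_eq]
      refine ⟨?_, h6⟩
      have : 0 ≤ δ' * M := mul_nonneg hδ'.le hM0
      change |r' - t| < δ
      linarith
    have h8 := hc (x := (r', X k r')) ⟨⟨hr'0, hrb.trans_lt hbT⟩, Set.mem_univ _⟩ h7
    rw [dist_eq_norm] at h8
    exact h8.le
  -- For fixed s the estimate holds for almost all k and passes to the limit; no uniform convergence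
  -- is needed.
  refine le_of_tendsto ?_ hev
  exact (((hx0 s hsT).sub (hx0 t ht)).sub_const _).norm

end Peano

/-! ### Smoothness of the feedback -/

theorem contDiffOn_inv_sub {F : Type*} [NormedAddCommGroup F] [NormedSpace ℝ F] (T : ℝ) :
    ContDiffOn ℝ ∞ (fun p : ℝ × F => (T - p.1)⁻¹) (Set.Ico 0 T ×ˢ Set.univ) :=
  ContDiffOn.inv (contDiff_const.sub contDiff_fst).contDiffOn
    fun _ hp => (sub_pos.mpr hp.1.2).ne'

theorem contDiff_coord {n : ℕ} (i : Fin n) :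
    ContDiff ℝ ∞ (fun x : EuclideanSpace ℝ (Fin n) => x i) :=
  (EuclideanSpace.proj (𝕜 := ℝ) i).contDiff

/-- Through `control_eq` the gain defined by choice is replaced by explicit powers of 1/(T - t),
smooth for t < T. -/
theorem contDiffOn_control {n : ℕ} [NeZero n] {T : ℝ} (hT : 0 < T) (β : ℝ) :
    ContDiffOn ℝ ∞ (fun p : ℝ × EuclideanSpace ℝ (Fin n) => control T β p.1 p.2)
      (Set.Ico 0 T ×ˢ Set.univ) := by
  have hinv := contDiffOn_inv_sub (F := EuclideanSpace ℝ (Fin n)) T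
  refine ContDiffOn.congr ?_ fun p hp => control_eq hT β hp.1.2 p.2
  refine ((contDiffOn_const.mul hinv).mul ?_).neg
  simp only [dotProduct, Matrix.mulVec, rescale]
  refine ContDiffOn.sum fun i _ => contDiffOn_const.mul (ContDiffOn.sum fun j _ => ?_)
  exact contDiffOn_const.mul ((hinv.pow _).mul ((contDiff_coord j).comp contDiff_snd).contDiffOn)

theorem observerField_eq {n : ℕ} [NeZero n] {T : ℝ} (hT : 0 < T) (β : ℝ) {t : ℝ} (ht : t < T)
    (u : ℝ) (y : ℝ × ℝ) (ξ : EuclideanSpace ℝ (Fin n)) (i : Fin n) :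
    observerField T β t u y ξ i =
      β * (if h : (i : ℕ) + 1 < n then ξ ⟨(i : ℕ) + 1, h⟩ else 0) + vecB n i * u
        + β * ((T - t)⁻¹ ^ ((i : ℕ) + ((0 : Fin n) : ℕ) + 1) * matQ₁ n i 0) *
          ((T - t)⁻¹ ^ (n - 1) * y.2 - ξ 0) := by
  rw [observerField, gam_eq hT, mulVec_vecC, matQ_apply n (inv_pos.mpr (sub_pos.mpr ht)),
    vecC_dotProduct, shiftA_mulVec_apply]

theorem smoothFeedback {n : ℕ} [NeZero n] {T : ℝ} (hT : 0 < T) (β : ℝ) :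
    SmoothFeedback n T β := by
  refine ⟨?_, contDiffOn_control hT β, fun i => ?_⟩
  · have hinv := contDiffOn_inv_sub (F := ℝ × ℝ) T
    simp only [control0, div_eq_mul_inv]
    refine ContDiffOn.sub ((contDiffOn_const.mul hinv).neg.mul ?_) ?_
    · exact (contDiff_fst.comp contDiff_snd).contDiffOn
    · exact (contDiff_const.mul (contDiff_const.sub contDiff_fst)).contDiffOn
  · have hinv := contDiffOn_inv_sub (F := ℝ × (ℝ × ℝ) × EuclideanSpace ℝ (Fin n)) T
    have hξ : ∀ j, ContDiff ℝ ∞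
        (fun p : ℝ × ℝ × (ℝ × ℝ) × EuclideanSpace ℝ (Fin n) => p.2.2.2 j) := fun j =>
      (contDiff_coord j).comp (contDiff_snd.comp (contDiff_snd.comp contDiff_snd))
    refine ContDiffOn.congr ?_ fun p hp => observerField_eq hT β hp.1.2 _ _ _ i
    refine ContDiffOn.add (ContDiffOn.add (contDiffOn_const.mul ?_) ?_) (ContDiffOn.mul ?_ ?_)
    · split_ifs with h
      · exact (hξ _).contDiffOn
      · exact contDiffOn_const
    · exact (contDiff_const.mul (contDiff_fst.comp contDiff_snd)).contDiffOn
    · exact contDiffOn_const.mul ((hinv.pow _).mul contDiffOn_const)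
    · refine ContDiffOn.sub ((hinv.pow _).mul ?_) (hξ 0).contDiffOn
      exact (contDiff_snd.comp
        (contDiff_fst.comp (contDiff_snd.comp contDiff_snd))).contDiffOn

/-! ### Existence of closed-loop solutions -/

/-- A continuous map is bounded on the compact set [0, b] × unit sphere, and homogeneity extends the
bound to all y. -/
theorem exists_linear_growth_of_homogeneous {E F : Type*} [NormedAddCommGroup E] [NormedSpace ℝ E]
    [FiniteDimensional ℝ E] [NormedAddCommGroup F] [NormedSpace ℝ F] {g : ℝ → E → F} {b : ℝ}
    (hg : ContinuousOn (fun p : ℝ × E => g p.1 p.2) (Set.Icc 0 b ×ˢ Set.univ))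
    (hhom : ∀ t ∈ Set.Icc 0 b, ∀ (r : ℝ) y, g t (r • y) = r • g t y) :
    ∃ K, 0 ≤ K ∧ ∀ t ∈ Set.Icc 0 b, ∀ y, ‖g t y‖ ≤ K * ‖y‖ := by
  have hc : IsCompact (Set.Icc (0 : ℝ) b ×ˢ Metric.sphere (0 : E) 1) :=
    isCompact_Icc.prod (isCompact_sphere 0 1)
  obtain ⟨C, hC⟩ := hc.exists_bound_of_continuousOn
    (hg.mono (Set.prod_mono le_rfl (Set.subset_univ _)))
  refine ⟨max C 0, le_max_right _ _, fun t ht y => ?_⟩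
  rcases eq_or_ne y 0 with rfl | hy
  · have := hhom t ht 0 0
    rw [zero_smul, zero_smul] at this
    simp [this]
  · have hy' : ‖y‖ ≠ 0 := norm_ne_zero_iff.mpr hy
    have h1 := hC (t, ‖y‖⁻¹ • y) ⟨ht, by simp [norm_smul, inv_mul_cancel₀ hy']⟩
    have h2 : g t y = ‖y‖ • g t (‖y‖⁻¹ • y) := by
      rw [← hhom t ht, smul_smul, mul_inv_cancel₀ hy', one_smul]
    rw [h2, norm_smul, norm_norm, mul_comm]
    exact mul_le_mul_of_nonneg_right (h1.trans (le_max_left _ _)) (norm_nonneg _)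

/-- The vector field of the `(x, ξ)`-part of the closed loop. -/
noncomputable def loopField {n : ℕ} [NeZero n] (T β : ℝ) (v₀ : ℝ → ℝ)
    (φ : Fin n → ℝ → ℝ → EuclideanSpace ℝ (Fin n) → ℝ) (t : ℝ)
    (z : (Fin n → ℝ) × (Fin n → ℝ)) : (Fin n → ℝ) × (Fin n → ℝ) :=
  (plantField φ t (v₀ t) (control T β t (WithLp.toLp 2 z.2)) (WithLp.toLp 2 z.1),
    -- The first output may be set to 0 because the observer reads only the second.
    observerField T β t (control T β t (WithLp.toLp 2 z.2)) (0, z.1 0) (WithLp.toLp 2 z.2))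

theorem continuousOn_loopField {n : ℕ} [NeZero n] {T : ℝ} (hT : 0 < T) (β : ℝ) {v₀ : ℝ → ℝ}
    (hv₀ : Continuous v₀) {φ : Fin n → ℝ → ℝ → EuclideanSpace ℝ (Fin n) → ℝ}
    (hφ : ∀ i, ContinuousOn
      (fun p : ℝ × ℝ × EuclideanSpace ℝ (Fin n) => φ i p.1 p.2.1 p.2.2)
      (Set.Ico 0 T ×ˢ Set.univ)) :
    ContinuousOn (fun p : ℝ × ((Fin n → ℝ) × (Fin n → ℝ)) => loopField T β v₀ φ p.1 p.2)
      (Set.Ico 0 T ×ˢ Set.univ) := by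
  have hξ : Continuous (fun p : ℝ × ((Fin n → ℝ) × (Fin n → ℝ)) =>
      (WithLp.toLp 2 p.2.2 : EuclideanSpace ℝ (Fin n))) :=
    (PiLp.continuous_toLp 2 _).comp (continuous_snd.comp continuous_snd)
  have hx : Continuous (fun p : ℝ × ((Fin n → ℝ) × (Fin n → ℝ)) =>
      (WithLp.toLp 2 p.2.1 : EuclideanSpace ℝ (Fin n))) :=
    (PiLp.continuous_toLp 2 _).comp (continuous_fst.comp continuous_snd)
  have hu : ContinuousOn (fun p : ℝ × ((Fin n → ℝ) × (Fin n → ℝ)) =>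
      control T β p.1 (WithLp.toLp 2 p.2.2 : EuclideanSpace ℝ (Fin n)))
      (Set.Ico 0 T ×ˢ Set.univ) :=
    ContinuousOn.comp (g := fun p : ℝ × EuclideanSpace ℝ (Fin n) => control T β p.1 p.2)
      (f := fun p : ℝ × ((Fin n → ℝ) × (Fin n → ℝ)) =>
        (p.1, (WithLp.toLp 2 p.2.2 : EuclideanSpace ℝ (Fin n))))
      (t := Set.Ico 0 T ×ˢ Set.univ)
      (contDiffOn_control (n := n) hT β).continuousOn
      (continuous_fst.prodMk hξ).continuousOn fun p hp => ⟨hp.1, Set.mem_univ _⟩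
  refine ContinuousOn.prodMk (continuousOn_pi.mpr fun i => ?_) (continuousOn_pi.mpr fun i => ?_)
  · refine ContinuousOn.add ?_ ?_
    · by_cases h : (i : ℕ) + 1 < n
      · simp only [dif_pos h]
        exact ((hv₀.comp continuous_fst).mul
          ((continuous_apply _).comp (continuous_fst.comp continuous_snd))).continuousOn
      · simp only [dif_neg h]
        exact hu
    · exact (hφ i).comp (continuousOn_fst.prodMk (hu.prodMk hx.continuousOn))
        fun p hp => ⟨hp.1, Set.mem_univ _⟩
  · have hy : Continuous (fun p : ℝ × ((Fin n → ℝ) × (Fin n → ℝ)) => ((0 : ℝ), p.2.1 0)) :=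
      continuous_const.prodMk ((continuous_apply _).comp (continuous_fst.comp continuous_snd))
    have hobs : ContinuousOn
        (fun p : ℝ × ℝ × (ℝ × ℝ) × EuclideanSpace ℝ (Fin n) =>
          observerField T β p.1 p.2.1 p.2.2.1 p.2.2.2 i) (Set.Ico 0 T ×ˢ Set.univ) :=
      ((smoothFeedback (n := n) hT β).2.2 i).continuousOn
    have hin : ContinuousOn (fun p : ℝ × ((Fin n → ℝ) × (Fin n → ℝ)) =>
        ((p.1, control T β p.1 (WithLp.toLp 2 p.2.2), ((0 : ℝ), p.2.1 0), WithLp.toLp 2 p.2.2) :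
          ℝ × ℝ × (ℝ × ℝ) × EuclideanSpace ℝ (Fin n))) (Set.Ico 0 T ×ˢ Set.univ) :=
      continuousOn_fst.prodMk (hu.prodMk (hy.continuousOn.prodMk hξ.continuousOn))
    have hmaps : Set.MapsTo (fun p : ℝ × ((Fin n → ℝ) × (Fin n → ℝ)) =>
        ((p.1, control T β p.1 (WithLp.toLp 2 p.2.2), ((0 : ℝ), p.2.1 0), WithLp.toLp 2 p.2.2) :
          ℝ × ℝ × (ℝ × ℝ) × EuclideanSpace ℝ (Fin n))) (Set.Ico 0 T ×ˢ Set.univ)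
        (Set.Ico 0 T ×ˢ Set.univ) := fun p hp => ⟨hp.1, Set.mem_univ _⟩
    exact ContinuousOn.comp (g := fun p : ℝ × ℝ × (ℝ × ℝ) × EuclideanSpace ℝ (Fin n) =>
        observerField T β p.1 p.2.1 p.2.2.1 p.2.2.2 i)
      (f := fun p : ℝ × ((Fin n → ℝ) × (Fin n → ℝ)) =>
        ((p.1, control T β p.1 (WithLp.toLp 2 p.2.2), ((0 : ℝ), p.2.1 0), WithLp.toLp 2 p.2.2) :
          ℝ × ℝ × (ℝ × ℝ) × EuclideanSpace ℝ (Fin n))) hobs hin hmaps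

theorem loopField_linear_growth {n : ℕ} [NeZero n] {T : ℝ} (hT : 0 < T) (β : ℝ) {v₀ : ℝ → ℝ}
    (hv₀ : Continuous v₀) {c : Fin n → Fin n → ℝ}
    {φ : Fin n → ℝ → ℝ → EuclideanSpace ℝ (Fin n) → ℝ} (hφ : Admissible T c φ) {b : ℝ}
    (hb : b < T) :
    ∃ K, 0 ≤ K ∧ ∀ t ∈ Set.Icc 0 b, ∀ z, ‖loopField T β v₀ φ t z‖ ≤ K * ‖z‖ := by
  have hsub : Set.Icc 0 b ⊆ Set.Ico 0 T := fun t ht => ⟨ht.1, ht.2.trans_lt hb⟩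
  -- Without φ the field is homogeneous in z; φ is added back through its own growth bound.
  have hlin := exists_linear_growth_of_homogeneous
    (g := loopField T β v₀ (fun (_ : Fin n) _ _ _ => 0)) (b := b)
    ((continuousOn_loopField hT β hv₀ (fun _ => continuousOn_const)).mono
      (Set.prod_mono hsub le_rfl)) (by
      intro t ht r z
      have hu : control T β t (WithLp.toLp 2 (r • z.2) : EuclideanSpace ℝ (Fin n)) =
          r * control T β t (WithLp.toLp 2 z.2 : EuclideanSpace ℝ (Fin n)) := by
        simp only [control, Matrix.mulVec_smul, dotProduct_smul, smul_eq_mul]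
        ring
      refine Prod.ext (funext fun i => ?_) (funext fun i => ?_)
      · simp only [loopField, plantField, Prod.smul_fst, Prod.smul_snd, Pi.smul_apply,
          smul_eq_mul, hu]
        split_ifs <;> ring
      · simp only [loopField, observerField, Prod.smul_fst, Prod.smul_snd, Pi.smul_apply,
          smul_eq_mul, hu, Matrix.mulVec_smul, dotProduct_smul]
        ring)
  obtain ⟨K, hK, hK'⟩ := hlin
  set C := ∑ i, ∑ j, |c i j|
  have hC : 0 ≤ C := Finset.sum_nonneg fun i _ => Finset.sum_nonneg fun j _ => abs_nonneg _
  refine ⟨K + C, by positivity, fun t ht z => ?_⟩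
  have hdec : loopField T β v₀ φ t z = loopField T β v₀ (fun (_ : Fin n) _ _ _ => 0) t z +
      (fun i => φ i t (control T β t (WithLp.toLp 2 z.2)) (WithLp.toLp 2 z.1), 0) := by
    refine Prod.ext (funext fun i => ?_) (funext fun i => ?_)
    · simp [loopField, plantField]
    · simp [loopField]
  have hφn : ‖(fun i => φ i t (control T β t (WithLp.toLp 2 z.2)) (WithLp.toLp 2 z.1))‖
      ≤ C * ‖z‖ := by
    rw [pi_norm_le_iff_of_nonneg (by positivity)]
    intro i
    refine (hφ.2 i t (hsub ht) _ _).trans ?_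
    have h1 : ∀ j ∈ Finset.Iic i, c i j * |(WithLp.toLp 2 z.1 : EuclideanSpace ℝ (Fin n)) j| ≤
        |c i j| * ‖z‖ := by
      intro j _
      exact mul_le_mul (le_abs_self _) ((norm_le_pi_norm z.1 j).trans (norm_fst_le z))
        (abs_nonneg _) (abs_nonneg _)
    refine (Finset.sum_le_sum h1).trans ?_
    rw [← Finset.sum_mul]
    refine mul_le_mul_of_nonneg_right ?_ (norm_nonneg _)
    refine (Finset.sum_le_sum_of_subset_of_nonneg (Finset.subset_univ _)
      fun _ _ _ => abs_nonneg _).trans ?_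
    exact Finset.single_le_sum (f := fun i => ∑ j, |c i j|)
      (fun i _ => Finset.sum_nonneg fun j _ => abs_nonneg _) (Finset.mem_univ i)
  rw [hdec, add_mul]
  refine (norm_add_le _ _).trans (add_le_add (hK' t ht z) ?_)
  rw [Prod.norm_def, norm_zero]
  exact max_le hφn (by positivity)

/-- Prescribing x₀ and u₀ by their closed forms decouples them, leaving a system in (x, ξ) to which
the Peano theorem applies. -/
theorem exists_closedLoop {n : ℕ} [NeZero n] {T : ℝ} (hT : 0 < T) (β : ℝ)
    {c : Fin n → Fin n → ℝ} {φ : Fin n → ℝ → ℝ → EuclideanSpace ℝ (Fin n) → ℝ}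
    (hφ : Admissible T c φ) (a₀ : ℝ) (a α : EuclideanSpace ℝ (Fin n)) :
    ∃ (x₀ : ℝ → ℝ) (x ξ : ℝ → EuclideanSpace ℝ (Fin n)) (u₀ u : ℝ → ℝ),
      IsClosedLoop T β φ T x₀ x ξ u₀ u ∧ x₀ 0 = a₀ ∧ x 0 = a ∧ ξ 0 = α := by
  set κ := a₀ / T ^ 3 + β / (2 * T) with hκ
  let v₀ : ℝ → ℝ := fun t => (T - t) * (β - 3 * (T - t) * κ)
  have hv₀ : Continuous v₀ := by fun_prop
  obtain ⟨z, hz0, hz⟩ := exists_solution_of_linear_growth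
    (continuousOn_loopField hT β hv₀ hφ.1)
    (fun b hb => loopField_linear_growth hT β hv₀ hφ hb) (a.ofLp, α.ofLp)
  let x₀ : ℝ → ℝ := fun t => (T - t) ^ 3 * κ - β / 2 * (T - t) ^ 2
  have hu₀ : ∀ t ∈ Set.Ico 0 T, ∀ y, v₀ t = control0 T β t (x₀ t, y) := by
    intro t ht y
    have hne : T - t ≠ 0 := (sub_pos.mpr ht.2).ne'
    simp only [v₀, x₀, control0]
    field_simp
    ring
  refine ⟨x₀, fun t => WithLp.toLp 2 (z t).1, fun t => WithLp.toLp 2 (z t).2, v₀,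
    fun t => control T β t (WithLp.toLp 2 (z t).2), ⟨?_, ?_, ?_, ?_, ?_⟩, ?_, ?_, ?_⟩
  · intro t _
    have h := ((hasDerivAt_id t).const_sub T)
    have h2 := ((h.pow 3).mul_const κ).sub ((h.pow 2).const_mul (β / 2))
    refine (h2.congr_deriv ?_).hasDerivWithinAt
    simp [v₀]
    ring
  · intro t ht i
    have h := ((ContinuousLinearMap.proj (R := ℝ) (φ := fun _ : Fin n => ℝ) i).comp
      (ContinuousLinearMap.fst ℝ (Fin n → ℝ) (Fin n → ℝ))).hasFDerivAt.comp_hasDerivWithinAt t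
      (hz t ht)
    exact h
  · intro t ht i
    have h := ((ContinuousLinearMap.proj (R := ℝ) (φ := fun _ : Fin n => ℝ) i).comp
      (ContinuousLinearMap.snd ℝ (Fin n → ℝ) (Fin n → ℝ))).hasFDerivAt.comp_hasDerivWithinAt t
      (hz t ht)
    exact h
  · intro t ht
    exact hu₀ t ht _
  · intro t _
    rfl
  · simp only [x₀, hκ, sub_zero]
    field_simp
    ring
  · simp [hz0]
  · simp [hz0]

/-! ### Convergence at time T and the main theorem -/

theorem tendsto_zero_of_bound {F : Type*} [NormedAddCommGroup F] {T : ℝ} (hT : 0 < T)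
    {x : ℝ → F} {B : ℝ → ℝ} (hB : Continuous B) (hB0 : B T = 0)
    (h : ∀ t ∈ Set.Ico 0 T, ‖x t‖ ≤ B t) : Filter.Tendsto x (𝓝[<] T) (𝓝 0) := by
  refine squeeze_zero_norm' (a := B) ?_ ?_
  · filter_upwards [Ico_mem_nhdsLT hT] with t ht using h t ht
  · rw [← hB0]
    exact hB.continuousAt.tendsto.mono_left nhdsWithin_le_nhds

theorem continuous_exp_mul_rpow (T υ ρ a N : ℝ) {p : ℝ} (hp : 0 ≤ p) :
    Continuous fun t => υ * Real.exp (ρ * a * t) * (T - t) ^ p * N := by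
  have h : Continuous fun t : ℝ => (T - t) ^ p :=
    (continuous_const.sub continuous_id).rpow_const fun _ => Or.inr hp
  fun_prop

end PrescribedTime

theorem theorem2 (n : ℕ) [NeZero n] (T : ℝ) (hT : 0 < T) (c : Fin n → Fin n → ℝ) :
    -- the gain matrices are well defined
    (∀ γ : ℝ, 0 < γ →
      ((∃! P, IsControlPLE n γ P) ∧ IsControlPLE n γ (matP n γ)) ∧
      ((∃! Q, IsObserverPLE n γ Q) ∧ IsObserverPLE n γ (matQ n γ))) ∧
    -- the feedback is smooth
    SmoothFeedback n T (beta T c) ∧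
    -- the constants depend only on `n`, `T` and the `c i j`
    ∃ υ₃ υ₃₀ υ₄ υ₄₀ υ₅ υ₅₀ : ℝ,
      0 < υ₃ ∧ 0 < υ₃₀ ∧ 0 < υ₄ ∧ 0 < υ₄₀ ∧ 0 < υ₅ ∧ 0 < υ₅₀ ∧
      ∀ φ : Fin n → ℝ → ℝ → EuclideanSpace ℝ (Fin n) → ℝ, Admissible T c φ →
        -- every initial condition has a closed-loop solution on the whole of `[0, T)`
        (∀ (a₀ : ℝ) (a α : EuclideanSpace ℝ (Fin n)),
          ∃ (x₀ : ℝ → ℝ) (x ξ : ℝ → EuclideanSpace ℝ (Fin n)) (u₀ u : ℝ → ℝ),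
            IsClosedLoop T (beta T c) φ T x₀ x ξ u₀ u ∧ x₀ 0 = a₀ ∧ x 0 = a ∧ ξ 0 = α) ∧
        -- every closed-loop solution, for as long as it is defined, obeys the bounds
        (∀ τ ∈ Set.Ioc 0 T,
          ∀ (x₀ : ℝ → ℝ) (x ξ : ℝ → EuclideanSpace ℝ (Fin n)) (u₀ u : ℝ → ℝ),
            IsClosedLoop T (beta T c) φ τ x₀ x ξ u₀ u →
            ∀ t ∈ Set.Ico 0 τ,
              |x₀ t| ≤ (T - t) ^ 2 *
                ((T - t) / T ^ 3 * |x₀ 0| + beta T c * t / (2 * T)) ∧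
              |u₀ t| ≤ (T - t) *
                (3 * (T - t) * (|x₀ 0| / T ^ 3 + beta T c / (2 * T)) + beta T c) ∧
              ‖x t‖ ≤ υ₃ * Real.exp (υ₃₀ * |x₀ 0| * t) * (T - t) ^ (3 / 2 : ℝ) *
                (‖x 0‖ + ‖ξ 0‖) ∧
              ‖ξ t‖ ≤ υ₄ * Real.exp (υ₄₀ * |x₀ 0| * t) * (T - t) ^ (3 / 2 : ℝ) *
                (‖x 0‖ + ‖ξ 0‖) ∧
              |u t| ≤ υ₅ * Real.exp (υ₅₀ * |x₀ 0| * t) * (T - t) ^ (1 / 2 : ℝ) *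
                (‖x 0‖ + ‖ξ 0‖)) ∧
        -- all states, observer states and controls converge to zero at time `T`
        (∀ (x₀ : ℝ → ℝ) (x ξ : ℝ → EuclideanSpace ℝ (Fin n)) (u₀ u : ℝ → ℝ),
          IsClosedLoop T (beta T c) φ T x₀ x ξ u₀ u →
            Filter.Tendsto x₀ (𝓝[<] T) (𝓝 0) ∧
            Filter.Tendsto x (𝓝[<] T) (𝓝 0) ∧
            Filter.Tendsto ξ (𝓝[<] T) (𝓝 0) ∧
            Filter.Tendsto u₀ (𝓝[<] T) (𝓝 0) ∧
            Filter.Tendsto u (𝓝[<] T) (𝓝 0)) := by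
  refine ⟨fun γ hγ => gain_matrices_wellDefined n hγ, smoothFeedback hT _, ?_⟩
  obtain ⟨M, ρ, hM, hρ, hbound⟩ := exists_closedLoop_bounds hT c
  have hβ := beta_pos T c
  have hMs : 0 < √M := Real.sqrt_pos.mpr hM
  -- The three estimates share one constant and one rate, chosen before φ.
  refine ⟨√M, ρ, √M, ρ, √M, ρ, hMs, hρ, hMs, hρ, hMs, hρ, fun φ hφ => ?_⟩
  have hall : ∀ τ ∈ Set.Ioc 0 T, ∀ (x₀ : ℝ → ℝ) (x ξ : ℝ → EuclideanSpace ℝ (Fin n))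
      (u₀ u : ℝ → ℝ), IsClosedLoop T (beta T c) φ τ x₀ x ξ u₀ u → ∀ t ∈ Set.Ico 0 τ,
      |x₀ t| ≤ (T - t) ^ 2 * ((T - t) / T ^ 3 * |x₀ 0| + beta T c * t / (2 * T)) ∧
      |u₀ t| ≤ (T - t) * (3 * (T - t) * (|x₀ 0| / T ^ 3 + beta T c / (2 * T)) + beta T c) ∧
      ‖x t‖ ≤ √M * Real.exp (ρ * |x₀ 0| * t) * (T - t) ^ (3 / 2 : ℝ) * (‖x 0‖ + ‖ξ 0‖) ∧
      ‖ξ t‖ ≤ √M * Real.exp (ρ * |x₀ 0| * t) * (T - t) ^ (3 / 2 : ℝ) * (‖x 0‖ + ‖ξ 0‖) ∧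
      |u t| ≤ √M * Real.exp (ρ * |x₀ 0| * t) * (T - t) ^ (1 / 2 : ℝ) * (‖x 0‖ + ‖ξ 0‖) := by
    intro τ hτ x₀ x ξ u₀ u h t ht
    have htT : t < T := ht.2.trans_le hτ.2
    have hs : 0 ≤ T - t := (sub_pos.mpr htT).le
    have hN : 0 ≤ ‖x 0‖ + ‖ξ 0‖ := by positivity
    obtain ⟨hx, hξ, hu⟩ := hbound φ hφ τ hτ.2 x₀ x ξ u₀ u h t ht
    have hx' := le_of_sq_le_rpow hM.le hs hN 3 hx
    have hξ' := le_of_sq_le_rpow hM.le hs hN 3 hξ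
    have hu' := le_of_sq_le_rpow hM.le hs hN 1 hu
    rw [abs_norm, Nat.cast_ofNat] at hx' hξ'
    rw [Nat.cast_one] at hu'
    refine ⟨?_, ?_, hx', hξ', hu'⟩
    · rw [h.x₀_eq hT hτ.2 ht]
      exact abs_x₀_le hT hβ ht.1 htT
    · rw [h.u₀_eq hT hτ.2 ht]
      exact abs_u₀_le hT hβ htT
  refine ⟨fun a₀ a α => exists_closedLoop hT _ hφ a₀ a α, hall, ?_⟩
  intro x₀ x ξ u₀ u h
  have hb := hall T ⟨hT, le_rfl⟩ x₀ x ξ u₀ u h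
  have h32 : (0 : ℝ) ≤ 3 / 2 := by norm_num
  have h12 : (0 : ℝ) ≤ 1 / 2 := by norm_num
  refine ⟨tendsto_zero_of_bound hT ?_ ?_ fun t ht => (hb t ht).1,
    tendsto_zero_of_bound hT (continuous_exp_mul_rpow T (√M) ρ |x₀ 0| (‖x 0‖ + ‖ξ 0‖) h32) ?_
      fun t ht => (hb t ht).2.2.1,
    tendsto_zero_of_bound hT (continuous_exp_mul_rpow T (√M) ρ |x₀ 0| (‖x 0‖ + ‖ξ 0‖) h32) ?_
      fun t ht => (hb t ht).2.2.2.1,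
    tendsto_zero_of_bound hT ?_ ?_ fun t ht => (hb t ht).2.1,
    tendsto_zero_of_bound hT (continuous_exp_mul_rpow T (√M) ρ |x₀ 0| (‖x 0‖ + ‖ξ 0‖) h12) ?_
      fun t ht => (hb t ht).2.2.2.2⟩
  · fun_prop
  · simp
  · simp [Real.zero_rpow]
  · simp [Real.zero_rpow]
  · fun_prop
  · simp
  · simp [Real.zero_rpow]
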